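/- Let $d\ge 1$. For $h>0$ and real functions $u=(u_j)_{j\in\mathbb Z^d}$ on the lattice $(h\mathbb Z)^d$, $u_j=u(hj)$, put $\Delta_{\mathrm d}u_j=h^{-2}\sum_{k=1}^d(u_{j+e_k}-2u_j+u_{j-e_k})$, and let $|\cdot|$ denote the Euclidean norm. Write $$B_r(u)=h^d\sum_{|hj|<r}|u_j|^2,\qquad A_R(u)=h^d\sum_{R-2<|hj|<R+1}|u_j|^2 .$$ Let $V:(h\mathbb Z)^d\to\mathbb R$ be bounded with $\|V\|_\infty\le M$, and let $u\in\ell^2((h\mathbb Z)^d)$ be a real solution of $\Delta_{\mathrm d}u_j+V_ju_j=0$, $j\in\mathbb Z^d$. A nontrivial $u$ has $B_{R-1}(u)\ge c$ for some $c>0$ and all large $R$; the bounds below are uniform over all $u$ with the same $c$ (one may normalise to $c=1$). 1. (Case $hR^{1/3}\le 1$.) There is a constant $C=C(d,M)>0$ such that for every $c>0$ there is $R_0=R_0(d,M,c)>0$ such that, for all $h>0$ and $R\ge R_0$ with $hR^{1/3}\le 1$ and all such $V,u$ with $B_{R-1}(u)\ge c$, $$e^{-CR^{4/3}}\le A_R(u).$$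 2. (Case $hR^{1/3}>1$.) There is a constant $C=C(d)>0$ with the following properties. (a) For all $M$ and $c>0$ there is $R_0=R_0(d,M,c)>0$ such that, for all $h>0$ and $R\ge R_0$ with $hR^{1/3}>1$ and all such $V,u$ with $B_{R-1}(u)\ge c$: if $h<1$, then $R=h^{-\beta}$ for some $\beta>3$ and $$e^{-CR^{1+1/\beta}\log(R^{1-1/\beta})}\le A_R(u);$$ and if $h<3/2$, then $e^{-C\frac Rh\log(Rh)}\le A_R(u)$. (b) For each fixed $h\in(0,3/2)$, each bounded $V$ and each nontrivial such $u$, there is $R_0>0$ such that $e^{-C\frac Rh\log(Rh)}\le A_R(u)$ for all $R\ge R_0$. -/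

import Mathlib

namespace LatticeSchrodinger

/-- Functions on the lattice `(hℤ)^d` are indexed by `j : Fin d → ℤ`, with `u j` standing for the
value at the point `h j`. `absPt h j` is the Euclidean length `|hj|`. -/
noncomputable def absPt {d : ℕ} (h : ℝ) (j : Fin d → ℤ) : ℝ :=
  ‖WithLp.toLp 2 (fun k => h * (j k : ℝ))‖

/-- The normalised discrete Laplacian on `(hℤ)^d`. -/
noncomputable def discreteLaplacian {d : ℕ} (h : ℝ) (u : (Fin d → ℤ) → ℝ) (j : Fin d → ℤ) : ℝ :=
  ∑ k : Fin d, (u (j + Pi.single k 1) - 2 * u j + u (j - Pi.single k 1)) / h ^ 2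

/-- `u ∈ ℓ²((hℤ)^d)` solves `Δ_d u + V u = 0` on the whole lattice. -/
def IsSolution {d : ℕ} (h : ℝ) (V u : (Fin d → ℤ) → ℝ) : Prop :=
  Memℓp u 2 ∧ ∀ j, discreteLaplacian h u j + V j * u j = 0

/-- `h^d ∑_{R-2 < |hj| < R+1} |u_j|²`. For `h > 0` the sum is finite. -/
noncomputable def annulusMass {d : ℕ} (h R : ℝ) (u : (Fin d → ℤ) → ℝ) : ℝ :=
  h ^ d * ∑' j : {j : Fin d → ℤ // R - 2 < absPt h j ∧ absPt h j < R + 1}, |u j| ^ 2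

/-- `h^d ∑_{|hj| < r} |u_j|²`. For `h > 0` the sum is finite. -/
noncomputable def ballMass {d : ℕ} (h r : ℝ) (u : (Fin d → ℤ) → ℝ) : ℝ :=
  h ^ d * ∑' j : {j : Fin d → ℤ // absPt h j < r}, |u j| ^ 2

end LatticeSchrodinger

/-! Replace `u` by a cut-off `v` that equals `u` for `|hj| < R - 1` and vanishes for `|hj| ≥ R + 1`.
Then `v` solves the equation up to an error `f` whose `ℓ²` norm is controlled by the annulus mass. A
Carleman inequality bounds `∑ v²` by `∑ f²` times an exponential, and since the ball mass is at
least `c`, the annulus mass cannot be smaller than the inverse of that exponential.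

The weight `exp ψ`, `ψ(n) = αn + ηn²/2`, depends on a single coordinate `n = j i`. Conjugating the
Laplacian by it gives `S + A` with `S` symmetric and `A` skew, and `‖(S + A)w‖² ≥ 4⟨Sw, Aw⟩`. The
diagonal of `S` and the translations in the other directions contribute nothing, and convexity of
`ψ` makes the rest at least `2 sinh η ∑ sinh²(α + ηn) w²` (`carleman_estimate`).

With `N = (R + 1)/h`, `α = 2Θ`, `η = Θ/N`, the argument `α + ηn` stays above `Θ` on the ball. The
potential is absorbed once `h⁴(M² + 1) ≤ 2 sinh(Θ/N) sinh²Θ`, and the loss is `exp(10ΘN)`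
(`tsum_sq_le_of_equation`). In the fine regime `sinh` is used linearly: `Θ` of order `h R^{1/3}`
suffices and `ΘN` is of order `R^{4/3}`. In the coarse regime its exponential growth allows `Θ =
log(Rh)`, so `ΘN` is about `(R/h) log(Rh)`.

A sharp cut-off costs `h⁻⁴`, which the exponential swallows in the coarse regime. The fine regime
needs a bound uniform in `h`: a `C^{1,1}` cut-off, with the first differences of `u` in the
commutator controlled by a discrete Caccioppoli inequality. -/

namespace LatticeSchrodinger

open Finset Function

/-! ### Translation invariance and finite support of lattice sums -/

section Summation

variable {G : Type*} [AddCommGroup G]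

lemma tsum_comp_add (F : G → ℝ) (a : G) : ∑' j, F (j + a) = ∑' j, F j :=
  (Equiv.addRight a).tsum_eq F

lemma tsum_comp_sub (F : G → ℝ) (a : G) : ∑' j, F (j - a) = ∑' j, F j :=
  (Equiv.subRight a).tsum_eq F

lemma summable_comp_add {F : G → ℝ} (hF : Summable F) (a : G) : Summable fun j => F (j + a) :=
  (Equiv.addRight a).summable_iff.2 hF

lemma summable_comp_sub {F : G → ℝ} (hF : Summable F) (a : G) : Summable fun j => F (j - a) :=
  (Equiv.subRight a).summable_iff.2 hF

lemma summable_of_support_finite {F w : G → ℝ} (hw : (support w).Finite) (a : G)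
    (hF : ∀ j, w (j + a) = 0 → F j = 0) : Summable F := by
  refine summable_of_hasFiniteSupport ((hw.preimage (add_left_injective a).injOn).subset ?_)
  intro j hj
  exact fun h => hj (hF j h)

end Summation

/-! ### Carleman estimate with a one-coordinate convex weight -/

section Carleman

variable {d : ℕ}

/-- The standard basis vector of `ℤ^d`. -/
def unitVec (k : Fin d) : Fin d → ℤ := Pi.single k 1

lemma unitVec_same (k : Fin d) : unitVec k k = 1 := by simp [unitVec]

lemma unitVec_of_ne {i k : Fin d} (hk : k ≠ i) : unitVec k i = 0 := by
  simp [unitVec, hk.symm]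

/-- The part of the conjugated Laplacian that is skew-symmetric for the weight depending on the
coordinate `i`. -/
noncomputable def skewPart (i : Fin d) (θ : ℤ → ℝ) (w : (Fin d → ℤ) → ℝ) (j : Fin d → ℤ) : ℝ :=
  -(Real.sinh (θ (j i)) * w (j + unitVec i)) +
    Real.sinh (θ (j i - 1)) * w (j - unitVec i)

/-- The symmetric part of the conjugated Laplacian acting in the direction `i`. -/
noncomputable def symmPart (i : Fin d) (θ : ℤ → ℝ) (w : (Fin d → ℤ) → ℝ) (j : Fin d → ℤ) : ℝ :=
  Real.cosh (θ (j i)) * w (j + unitVec i) +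
    Real.cosh (θ (j i - 1)) * w (j - unitVec i)

lemma tsum_mul_skewPart (i : Fin d) (θ : ℤ → ℝ) {w : (Fin d → ℤ) → ℝ} (hw : (support w).Finite) :
    ∑' j, w j * skewPart i θ w j = 0 := by
  set F : (Fin d → ℤ) → ℝ := fun j => Real.sinh (θ (j i)) * w j * w (j + unitVec i) with hF
  have hs : Summable F := summable_of_support_finite hw 0 fun j hj => by
    simp only [add_zero] at hj; simp [hF, hj]
  have hs' : Summable fun j => F (j - unitVec i) :=
    summable_comp_sub hs (unitVec i)
  have : ∀ j, w j * skewPart i θ w j = F (j - unitVec i) - F j := by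
    intro j; simp [hF, skewPart, unitVec_same]; ring
  simp_rw [this]
  rw [hs'.tsum_sub hs, tsum_comp_sub F, sub_self]

/-- Translations in a direction `k ≠ i` commute with the skew part, whose coefficients depend on `j
i` alone. A symmetric operator commuting with a skew one pairs to zero; concretely the summand
telescopes along `e_i + e_k` and `e_i - e_k`. -/
lemma tsum_translate_mul_skewPart {i k : Fin d} (hk : k ≠ i) (θ : ℤ → ℝ) {w : (Fin d → ℤ) → ℝ}
    (hw : (support w).Finite) :
    ∑' j, (w (j + unitVec k) + w (j - unitVec k)) * skewPart i θ w j = 0 := by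
  set F : (Fin d → ℤ) → ℝ :=
    fun j => Real.sinh (θ (j i)) * w (j + unitVec k) * w (j + unitVec i) with hF
  set H : (Fin d → ℤ) → ℝ :=
    fun j => Real.sinh (θ (j i)) * w (j - unitVec k) * w (j + unitVec i) with hH
  have hsF : Summable F := summable_of_support_finite hw (unitVec i) fun j hj => by
    simp [hF, hj]
  have hsH : Summable H := summable_of_support_finite hw (unitVec i) fun j hj => by
    simp [hH, hj]
  have hsF' : Summable fun j => F (j - (unitVec i + unitVec k)) :=
    summable_comp_sub hsF (unitVec i + unitVec k)
  have hsH' : Summable fun j => H (j - (unitVec i - unitVec k)) :=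
    summable_comp_sub hsH (unitVec i - unitVec k)
  have hki : unitVec k i = 0 := unitVec_of_ne hk
  have key : ∀ j, (w (j + unitVec k) + w (j - unitVec k)) * skewPart i θ w j =
      (F (j - (unitVec i + unitVec k)) - F j) +
        (H (j - (unitVec i - unitVec k)) - H j) := by
    intro j
    have e1 : j - (unitVec i + unitVec k) + unitVec k = j - unitVec i := by abel
    have e2 : j - (unitVec i + unitVec k) + unitVec i = j - unitVec k := by abel
    have e3 : j - (unitVec i - unitVec k) - unitVec k = j - unitVec i := by abel
    have e4 : j - (unitVec i - unitVec k) + unitVec i = j + unitVec k := by abel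
    simp only [hF, hH, skewPart, e1, e2, e3, e4]
    simp only [Pi.sub_apply, Pi.add_apply, hki, unitVec_same, add_zero, sub_zero]
    ring
  simp_rw [key]
  rw [(hsF'.sub hsF).tsum_add (hsH'.sub hsH), hsF'.tsum_sub hsF, hsH'.tsum_sub hsH,
    tsum_comp_sub F, tsum_comp_sub H]
  ring

/-- The positive commutator. After translation the diagonal terms give `cosh θ sinh θ` at `n` minus
the same at `n - 1`, which equals `sinh η cosh(θ n + θ (n - 1))`. The cross term has coefficient
`sinh(θ n - θ (n - 1)) = sinh η`, and bounding it by the arithmetic-geometric mean inequality costs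
the `-1`. -/
lemma le_tsum_symmPart_mul_skewPart (i : Fin d) (θ : ℤ → ℝ) {η : ℝ} (hη : 0 ≤ η)
    (hθ : ∀ n, θ n = θ (n - 1) + η) {w : (Fin d → ℤ) → ℝ} (hw : (support w).Finite) :
    Real.sinh η * ∑' j, (Real.cosh (θ (j i) + θ (j i - 1)) - 1) * w j ^ 2 ≤
      ∑' j, symmPart i θ w j * skewPart i θ w j := by
  set e : Fin d → ℤ := unitVec i with he
  set s := Real.sinh η
  have hs : 0 ≤ s := Real.sinh_nonneg_iff.2 hη
  set F : (Fin d → ℤ) → ℝ :=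
    fun j => Real.cosh (θ (j i - 1)) * Real.sinh (θ (j i - 1)) * w j ^ 2 with hF
  set H : (Fin d → ℤ) → ℝ :=
    fun j => Real.cosh (θ (j i)) * Real.sinh (θ (j i)) * w j ^ 2 with hH
  set Q : (Fin d → ℤ) → ℝ := fun j => s / 2 * w j ^ 2 with hQ
  have h0 : ∀ K : (Fin d → ℤ) → ℝ, Summable fun j => K j * w j ^ 2 := fun K =>
    summable_of_support_finite hw 0 fun j hj => by simp only [add_zero] at hj; simp [hj]
  have sF : Summable F := h0 _
  have sH : Summable H := h0 _
  have sQ : Summable Q := h0 fun _ => s / 2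
  have sF' : Summable fun j => F (j + e) := summable_comp_add sF e
  have sH' : Summable fun j => H (j - e) := summable_comp_sub sH e
  have sQ' : Summable fun j => Q (j + e) := summable_comp_add sQ e
  have sQ'' : Summable fun j => Q (j - e) := summable_comp_sub sQ e
  have sSA : Summable fun j => symmPart i θ w j * skewPart i θ w j := by
    have a : Summable fun j => Real.cosh (θ (j i)) * w (j + e) * skewPart i θ w j :=
      summable_of_support_finite hw e fun j hj => by simp [hj]
    have b : Summable fun j => Real.cosh (θ (j i - 1)) * w (j - e) * skewPart i θ w j :=
      summable_of_support_finite hw (-e) fun j hj => by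
        rw [← sub_eq_add_neg] at hj; simp [hj]
    exact (a.add b).congr fun j => by simp only [symmPart]; ring
  have pw : ∀ j, (H (j - e) - F (j + e)) - (Q (j + e) + Q (j - e)) ≤
      symmPart i θ w j * skewPart i θ w j := by
    intro j
    have hi : (j + e) i - 1 = j i := by simp [he, unitVec_same]
    have hi' : (j - e) i = j i - 1 := by simp [he, unitVec_same]
    have hsh : s = Real.sinh (θ (j i)) * Real.cosh (θ (j i - 1)) -
        Real.cosh (θ (j i)) * Real.sinh (θ (j i - 1)) := by
      rw [← Real.sinh_sub, hθ (j i)]; simp [s]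
    have id : symmPart i θ w j * skewPart i θ w j = (H (j - e) - F (j + e)) -
        s * (w (j + e) * w (j - e)) := by
      rw [hsh]
      simp only [symmPart, skewPart, hH, hF, hi, hi', ← he]
      ring
    rw [id]
    simp only [hQ]
    nlinarith [mul_nonneg hs (sq_nonneg (w (j + e) - w (j - e)))]
  have le := ((sH'.sub sF').sub (sQ'.add sQ'')).tsum_le_tsum pw sSA
  rw [(sH'.sub sF').tsum_sub (sQ'.add sQ''), sH'.tsum_sub sF', sQ'.tsum_add sQ'',
    tsum_comp_sub H, tsum_comp_add F, tsum_comp_add Q, tsum_comp_sub Q, ← sH.tsum_sub sF,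
    ← sQ.tsum_add sQ, ← (sH.sub sF).tsum_sub (sQ.add sQ)] at le
  rw [← tsum_mul_left]
  refine le_of_eq_of_le (tsum_congr fun j => ?_) le
  have e1 : s = Real.sinh (θ (j i) - θ (j i - 1)) := by rw [hθ (j i)]; simp [s]
  have hid : s * Real.cosh (θ (j i) + θ (j i - 1)) =
      Real.cosh (θ (j i)) * Real.sinh (θ (j i)) -
        Real.cosh (θ (j i - 1)) * Real.sinh (θ (j i - 1)) := by
    rw [e1, Real.sinh_sub, Real.cosh_add]
    have c1 := Real.cosh_sq (θ (j i))
    have c2 := Real.cosh_sq (θ (j i - 1))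
    linear_combination Real.sinh (θ (j i)) * Real.cosh (θ (j i)) * c2 -
      Real.cosh (θ (j i - 1)) * Real.sinh (θ (j i - 1)) * c1
  simp only [hH, hF, hQ]
  linear_combination w j ^ 2 * hid

/-- The unscaled discrete Laplacian. -/
def latticeLaplacian (v : (Fin d → ℤ) → ℝ) (j : Fin d → ℤ) : ℝ :=
  ∑ k : Fin d, (v (j + unitVec k) - 2 * v j + v (j - unitVec k))

lemma discreteLaplacian_eq (h : ℝ) (v : (Fin d → ℤ) → ℝ) (j : Fin d → ℤ) :
    discreteLaplacian h v j = latticeLaplacian v j / h ^ 2 := by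
  simp only [discreteLaplacian, latticeLaplacian, sum_div, unitVec]

/-- The quadratic Carleman exponent. -/
noncomputable def carlemanExponent (α η : ℝ) (n : ℤ) : ℝ := α * n + η * n ^ 2 / 2

/-- Here `θ n = ψ(n + 1) - ψ(n)`, so conjugation multiplies the two translations along `e_i` by
`exp(-θ n)` and `exp(θ (n - 1))`; `exp(±θ) = cosh θ ± sinh θ` splits these into symmetric and skew
parts. -/
lemma exp_mul_latticeLaplacian (i : Fin d) (α η : ℝ) (v : (Fin d → ℤ) → ℝ) (j : Fin d → ℤ) :
    Real.exp (carlemanExponent α η (j i)) * latticeLaplacian v j =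
      symmPart i (fun n => α + η * n + η / 2)
        (fun j => Real.exp (carlemanExponent α η (j i)) * v j) j +
      (-(2 * d * (Real.exp (carlemanExponent α η (j i)) * v j)) +
        ∑ k ∈ univ.erase i,
          (Real.exp (carlemanExponent α η ((j + unitVec k : Fin d → ℤ) i)) *
              v (j + unitVec k) +
            Real.exp (carlemanExponent α η ((j - unitVec k : Fin d → ℤ) i)) *
              v (j - unitVec k))) +
      skewPart i (fun n => α + η * n + η / 2)
        (fun j => Real.exp (carlemanExponent α η (j i)) * v j) j := by
  have h1 : latticeLaplacian v j = -(2 * d * v j) + ((v (j + unitVec i) +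
      v (j - unitVec i)) + ∑ k ∈ univ.erase i,
        (v (j + unitVec k) + v (j - unitVec k))) := by
    rw [add_sum_erase univ (fun k => v (j + unitVec k) + v (j - unitVec k)) (mem_univ i)]
    have : ∀ k : Fin d, v (j + unitVec k) - 2 * v j + v (j - unitVec k) =
      -(2 * v j) + (v (j + unitVec k) + v (j - unitVec k)) := fun k => by ring
    simp only [latticeLaplacian, this]
    rw [sum_add_distrib]
    simp
    ring
  have h2 : ∑ k ∈ univ.erase i,
          (Real.exp (carlemanExponent α η ((j + unitVec k : Fin d → ℤ) i)) *
              v (j + unitVec k) +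
            Real.exp (carlemanExponent α η ((j - unitVec k : Fin d → ℤ) i)) *
              v (j - unitVec k)) = Real.exp (carlemanExponent α η (j i)) *
      ∑ k ∈ univ.erase i, (v (j + unitVec k) + v (j - unitVec k)) := by
    rw [mul_sum]
    refine sum_congr rfl fun k hk => ?_
    have hki : unitVec k i = 0 := unitVec_of_ne (ne_of_mem_erase hk)
    simp only [Pi.add_apply, Pi.sub_apply, hki, add_zero, sub_zero]
    ring
  have h3 : Real.exp (carlemanExponent α η (j i)) =
      Real.exp (-(α + η * (j i : ℝ) + η / 2)) *
        Real.exp (carlemanExponent α η ((j + unitVec i : Fin d → ℤ) i)) := by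
    rw [← Real.exp_add]; congr 1
    simp only [carlemanExponent, Pi.add_apply, unitVec_same]; push_cast; ring
  have h4 : Real.exp (carlemanExponent α η (j i)) =
      Real.exp (α + η * ((j i - 1 : ℤ) : ℝ) + η / 2) *
        Real.exp (carlemanExponent α η ((j - unitVec i : Fin d → ℤ) i)) := by
    rw [← Real.exp_add]; congr 1
    simp only [carlemanExponent, Pi.sub_apply, unitVec_same]; push_cast; ring
  rw [h1, h2]
  simp only [symmPart, skewPart]
  have h5 := Real.cosh_sub_sinh (α + η * (j i : ℝ) + η / 2)
  have h6 := Real.cosh_add_sinh (α + η * ((j i - 1 : ℤ) : ℝ) + η / 2)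
  rw [← h5] at h3
  rw [← h6] at h4
  linear_combination v (j + unitVec i) * h3 + v (j - unitVec i) * h4

/-- Carleman estimate for the lattice Laplacian with a convex weight in one coordinate. -/
theorem carleman_estimate (i : Fin d) (α : ℝ) {η : ℝ} (hη : 0 ≤ η) {v : (Fin d → ℤ) → ℝ}
    (hv : (support v).Finite) :
    8 * Real.sinh η * ∑' j, Real.sinh (α + η * j i) ^ 2 *
        (Real.exp (carlemanExponent α η (j i)) * v j) ^ 2 ≤
      ∑' j, (Real.exp (carlemanExponent α η (j i)) * latticeLaplacian v j) ^ 2 := by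
  set θ : ℤ → ℝ := fun n => α + η * n + η / 2 with hθ
  set w : (Fin d → ℤ) → ℝ := fun j => Real.exp (carlemanExponent α η (j i)) * v j with hwdef
  have hw : (support w).Finite := hv.subset fun j hj hj' => hj (by simp [hwdef, hj'])
  have h1 := le_tsum_symmPart_mul_skewPart i θ hη (fun n => by simp only [hθ]; push_cast; ring) hw
  have sw (K : (Fin d → ℤ) → ℝ) (a : Fin d → ℤ) : Summable fun j => w (j + a) * K j :=
    summable_of_support_finite hw a fun j hj => by simp [hj]
  have sw' (K : (Fin d → ℤ) → ℝ) (a : Fin d → ℤ) : Summable fun j => w (j - a) * K j := by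
    simpa only [sub_eq_add_neg] using sw K (-a)
  have sw0 (K : (Fin d → ℤ) → ℝ) : Summable fun j => w j * K j := by simpa using sw K 0
  have sA : Summable fun j => symmPart i θ w j * skewPart i θ w j :=
    ((sw (fun j => Real.cosh (θ (j i)) * skewPart i θ w j) (unitVec i)).add
      (sw' (fun j => Real.cosh (θ (j i - 1)) * skewPart i θ w j) (unitVec i))).congr
      fun j => by simp only [symmPart]; ring
  have sB : Summable fun j => 2 * (d : ℝ) * (w j * skewPart i θ w j) := (sw0 _).mul_left _
  have sC : ∀ k ∈ univ.erase i, Summable fun j =>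
      (w (j + unitVec k) + w (j - unitVec k)) * skewPart i θ w j := fun k _ =>
    ((sw (skewPart i θ w) (unitVec k)).add (sw' (skewPart i θ w) (unitVec k))).congr
      fun j => by ring
  have sL : Summable fun j =>
      (Real.exp (carlemanExponent α η (j i)) * latticeLaplacian v j) ^ 2 := by
    set E : (Fin d → ℤ) → ℝ := fun j =>
      Real.exp (carlemanExponent α η (j i)) ^ 2 * latticeLaplacian v j with hE
    have sv (K : (Fin d → ℤ) → ℝ) (a : Fin d → ℤ) : Summable fun j => v (j + a) * K j :=
      summable_of_support_finite hv a fun j hj => by simp [hj]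
    have : ∀ k ∈ (univ : Finset (Fin d)), Summable fun j =>
        (v (j + unitVec k) * E j - 2 * (v (j + 0) * E j)) +
          v (j + -unitVec k) * E j :=
      fun k _ => ((sv _ _).sub ((sv _ _).mul_left 2)).add (sv _ _)
    refine (summable_sum this).congr fun j => ?_
    calc _ = ∑ k : Fin d, (v (j + unitVec k) - 2 * v j + v (j - unitVec k)) * E j := by
          refine sum_congr rfl fun k _ => ?_
          rw [add_zero, sub_eq_add_neg j]; ring
      _ = latticeLaplacian v j * E j := by rw [← sum_mul]; rfl
      _ = _ := by simp only [hE]; ring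
  -- Pointwise `(S + A)² - (S - A)² = 4SA`, so `(S + A)² ≥ 4SA`.
  have pw : ∀ j, 4 * (symmPart i θ w j * skewPart i θ w j - 2 * (d : ℝ) * (w j * skewPart i θ w j) +
      ∑ k ∈ univ.erase i, (w (j + unitVec k) + w (j - unitVec k)) * skewPart i θ w j) ≤
      (Real.exp (carlemanExponent α η (j i)) * latticeLaplacian v j) ^ 2 := by
    intro j
    rw [exp_mul_latticeLaplacian, ← sum_mul]
    change 4 * (symmPart i θ w j * skewPart i θ w j - 2 * (d : ℝ) * (w j * skewPart i θ w j) +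
      (∑ k ∈ univ.erase i, (w (j + unitVec k) + w (j - unitVec k))) * skewPart i θ w j) ≤
      (symmPart i θ w j + (-(2 * d * w j) +
        ∑ k ∈ univ.erase i, (w (j + unitVec k) + w (j - unitVec k))) +
        skewPart i θ w j) ^ 2
    generalize ∑ k ∈ univ.erase i, (w (j + unitVec k) + w (j - unitVec k)) = T
    nlinarith [sq_nonneg (symmPart i θ w j + (-(2 * d * w j) + T) - skewPart i θ w j)]
  have le := (((sA.sub sB).add (summable_sum sC)).mul_left 4).tsum_le_tsum pw sL
  rw [tsum_mul_left, (sA.sub sB).tsum_add (summable_sum sC), sA.tsum_sub sB, tsum_mul_left,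
    tsum_mul_skewPart i θ hw, Summable.tsum_finsetSum sC, sum_eq_zero fun k hk =>
      tsum_translate_mul_skewPart (ne_of_mem_erase hk) θ hw] at le
  have h2 : ∑' j : Fin d → ℤ, (Real.cosh (θ (j i) + θ (j i - 1)) - 1) * w j ^ 2 =
      2 * ∑' j : Fin d → ℤ, Real.sinh (α + η * j i) ^ 2 * w j ^ 2 := by
    rw [← tsum_mul_left]
    refine tsum_congr fun j => ?_
    have : θ (j i) + θ (j i - 1) = 2 * (α + η * j i) := by simp only [hθ]; push_cast; ring
    rw [this, Real.cosh_two_mul, Real.cosh_sq]; ring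
  rw [h2] at h1
  linarith

end Carleman

/-! ### Euclidean length on the lattice and the annulus density -/

section Geometry

variable {d : ℕ}

lemma absPt_nonneg (h : ℝ) (j : Fin d → ℤ) : 0 ≤ absPt h j := norm_nonneg _

lemma absPt_sq (h : ℝ) (j : Fin d → ℤ) : absPt h j ^ 2 = ∑ k, (h * (j k : ℝ)) ^ 2 := by
  rw [absPt, EuclideanSpace.norm_sq_eq]
  exact sum_congr rfl fun k _ => by rw [Real.norm_eq_abs, sq_abs]

lemma abs_coord_le_absPt (h : ℝ) (j : Fin d → ℤ) (k : Fin d) : |h * (j k : ℝ)| ≤ absPt h j := by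
  rw [← Real.norm_eq_abs]
  exact PiLp.norm_apply_le (WithLp.toLp 2 (fun k => h * (j k : ℝ)) : EuclideanSpace ℝ (Fin d)) k

lemma norm_smul_unitVec {h : ℝ} (hh : 0 < h) (k : Fin d) :
    ‖(WithLp.toLp 2 (fun l => h * (unitVec k l : ℝ)) : EuclideanSpace ℝ (Fin d))‖ = h := by
  have : (WithLp.toLp 2 (fun l => h * (unitVec k l : ℝ)) : EuclideanSpace ℝ (Fin d)) =
      EuclideanSpace.single k h := by
    ext l
    by_cases hl : l = k <;> simp [unitVec, hl]
  rw [this]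
  simp [abs_of_pos hh]

lemma absPt_add_unitVec_le {h : ℝ} (hh : 0 < h) (j : Fin d → ℤ) (k : Fin d) :
    |absPt h (j + unitVec k) - absPt h j| ≤ h := by
  have e : (WithLp.toLp 2 (fun l => h * ((j + unitVec k) l : ℝ)) : EuclideanSpace ℝ (Fin d)) -
      WithLp.toLp 2 (fun l => h * (j l : ℝ)) = WithLp.toLp 2 (fun l => h * (unitVec k l : ℝ)) := by
    ext l
    simp; ring
  have := abs_norm_sub_norm_le
    (WithLp.toLp 2 (fun l => h * ((j + unitVec k) l : ℝ)) : EuclideanSpace ℝ (Fin d))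
    (WithLp.toLp 2 (fun l => h * (j l : ℝ)))
  rwa [e, norm_smul_unitVec hh] at this

lemma absPt_sub_unitVec_le {h : ℝ} (hh : 0 < h) (j : Fin d → ℤ) (k : Fin d) :
    |absPt h (j - unitVec k) - absPt h j| ≤ h := by
  have := absPt_add_unitVec_le hh (j - unitVec k) k
  rwa [sub_add_cancel, abs_sub_comm] at this

lemma finite_absPt_lt {h : ℝ} (hh : 0 < h) (r : ℝ) : {j : Fin d → ℤ | absPt h j < r}.Finite := by
  obtain ⟨m, hm⟩ := exists_nat_gt (r / h)
  refine (Set.finite_Icc (fun _ : Fin d => -(m : ℤ)) (fun _ => (m : ℤ))).subset fun j hj => ?_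
  have key : ∀ k, |(j k : ℝ)| ≤ m := fun k => by
    have h1 := (abs_coord_le_absPt h j k).trans hj.out.le
    rw [abs_mul, abs_of_pos hh, mul_comm, ← le_div_iff₀ hh] at h1
    exact h1.trans hm.le
  refine ⟨fun k => ?_, fun k => ?_⟩
  · exact_mod_cast (abs_le.1 (key k)).1
  · exact_mod_cast (abs_le.1 (key k)).2

lemma support_finite_of_absPt_lt {h : ℝ} (hh : 0 < h) {r : ℝ} {v : (Fin d → ℤ) → ℝ}
    (hv : ∀ j, v j ≠ 0 → absPt h j < r) : (support v).Finite :=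
  (finite_absPt_lt hh r).subset fun j hj => hv j hj

/-- `|u_j|²` restricted to the annulus `R - 2 < |hj| < R + 1`. -/
noncomputable def annulusDensity (h R : ℝ) (u : (Fin d → ℤ) → ℝ) : (Fin d → ℤ) → ℝ :=
  {j | R - 2 < absPt h j ∧ absPt h j < R + 1}.indicator fun j => |u j| ^ 2

lemma annulusMass_eq (h R : ℝ) (u : (Fin d → ℤ) → ℝ) :
    annulusMass h R u = h ^ d * ∑' j, annulusDensity h R u j := by
  rw [annulusMass, annulusDensity, ← _root_.tsum_subtype]; rfl

lemma annulusDensity_of_mem {h R : ℝ} {u : (Fin d → ℤ) → ℝ} {j : Fin d → ℤ}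
    (h1 : R - 2 < absPt h j) (h2 : absPt h j < R + 1) : annulusDensity h R u j = u j ^ 2 := by
  rw [annulusDensity, Set.indicator_of_mem (by exact ⟨h1, h2⟩), sq_abs]

lemma annulusDensity_nonneg (h R : ℝ) (u : (Fin d → ℤ) → ℝ) (j : Fin d → ℤ) :
    0 ≤ annulusDensity h R u j := Set.indicator_nonneg (fun _ _ => by positivity) j

lemma summable_annulusDensity {h : ℝ} (hh : 0 < h) (R : ℝ) (u : (Fin d → ℤ) → ℝ) :
    Summable (annulusDensity h R u) :=
  summable_of_hasFiniteSupport <| (finite_absPt_lt hh (R + 1)).subset fun j hj => by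
    by_contra hc
    exact hj (Set.indicator_of_notMem (fun hm => hc hm.2) _)

end Geometry

/-! ### Absorbing the potential and removing the weight -/

section WeightedBound

variable {d : ℕ}

lemma abs_carlemanExponent_le {N Θ x : ℝ} {n : ℤ} (hN : 0 < N) (hΘ : 0 ≤ Θ) (hx : x = n)
    (hn : |x| ≤ N) : |carlemanExponent (2 * Θ) (Θ / N) n| ≤ 5 / 2 * (Θ * N) := by
  have e : carlemanExponent (2 * Θ) (Θ / N) n = 2 * Θ * x + Θ / N * x ^ 2 / 2 := by
    rw [carlemanExponent, hx]
  have h2 : x ^ 2 ≤ N ^ 2 := sq_le_sq' (abs_le.1 hn).1 (abs_le.1 hn).2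
  have h3 : Θ / N * x ^ 2 ≤ Θ * N := by
    calc Θ / N * x ^ 2 ≤ Θ / N * N ^ 2 := by gcongr
      _ = Θ * N := by field_simp
  have h4 : 0 ≤ Θ / N * x ^ 2 := by positivity
  have h5 := mul_le_mul_of_nonneg_left (abs_le.1 hn).1 hΘ
  have h6 := mul_le_mul_of_nonneg_left (abs_le.1 hn).2 hΘ
  rw [e, abs_le]
  constructor <;> nlinarith

/-- A compactly supported solution of the inhomogeneous equation is controlled by its
right-hand side. -/
theorem tsum_sq_le_of_equation (i : Fin d) {h R Θ M : ℝ} (hh : 0 < h) (hR : 0 < R) (hΘ : 0 < Θ)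
    (hcond : h ^ 4 * (M ^ 2 + 1) ≤ 2 * Real.sinh (Θ / ((R + 1) / h)) * Real.sinh Θ ^ 2)
    {V v f : (Fin d → ℤ) → ℝ} (hV : ∀ j, |V j| ≤ M)
    (hf : ∀ j, discreteLaplacian h v j + V j * v j = f j)
    (hv0 : ∀ j, v j ≠ 0 → absPt h j < R + 1) (hf0 : ∀ j, f j ≠ 0 → absPt h j < R + 1) :
    ∑' j, v j ^ 2 ≤ Real.exp (10 * (Θ * ((R + 1) / h))) * ∑' j, f j ^ 2 := by
  set N := (R + 1) / h with hNdef
  have hN : 0 < N := by positivity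
  set η := Θ / N with hη
  have hη0 : 0 < η := by positivity
  set E : (Fin d → ℤ) → ℝ := fun j => Real.exp (carlemanExponent (2 * Θ) η (j i)) with hE
  have hvs := support_finite_of_absPt_lt hh hv0
  have hfs := support_finite_of_absPt_lt hh hf0
  have sv (K : (Fin d → ℤ) → ℝ) : Summable fun j => K j * v j :=
    summable_of_support_finite hvs 0 fun j hj => by simp only [add_zero] at hj; simp [hj]
  have sf (K : (Fin d → ℤ) → ℝ) : Summable fun j => K j * f j :=
    summable_of_support_finite hfs 0 fun j hj => by simp only [add_zero] at hj; simp [hj]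
  have sv2 : Summable fun j => v j ^ 2 := (sv v).congr fun j => by ring
  have sf2 : Summable fun j => f j ^ 2 := (sf f).congr fun j => by ring
  have sEv : Summable fun j => (E j * v j) ^ 2 :=
    (sv fun j => E j ^ 2 * v j).congr fun j => by ring
  have sEf : Summable fun j => (E j * f j) ^ 2 :=
    (sf fun j => E j ^ 2 * f j).congr fun j => by ring
  have hbd : ∀ j : Fin d → ℤ, absPt h j < R + 1 → |(j i : ℝ)| ≤ N := fun j hj => by
    have h1 := (abs_coord_le_absPt h j i).trans hj.le
    rwa [abs_mul, abs_of_pos hh, mul_comm, ← le_div_iff₀ hh] at h1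
  have hψ : ∀ j : Fin d → ℤ, absPt h j < R + 1 →
      |carlemanExponent (2 * Θ) η (j i)| ≤ 5 / 2 * (Θ * N) := fun j hj =>
    abs_carlemanExponent_le hN hΘ.le rfl (hbd j hj)
  have car := carleman_estimate i (2 * Θ) hη0.le hvs
  have low : Real.sinh Θ ^ 2 * ∑' j, (E j * v j) ^ 2 ≤
      ∑' j : Fin d → ℤ, Real.sinh (2 * Θ + η * j i) ^ 2 * (E j * v j) ^ 2 := by
    rw [← tsum_mul_left]
    refine (sEv.mul_left _).tsum_le_tsum (fun j => ?_)
      ((sv fun j => Real.sinh (2 * Θ + η * j i) ^ 2 * (E j ^ 2 * v j)).congr fun j => by ring)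
    by_cases hj : v j = 0
    · simp [hj]
    have h1 := hbd j (hv0 j hj)
    -- The slope `α = 2Θ` outweighs `η n ≥ -Θ`, so the argument of `sinh` is at least `Θ` throughout
    -- the support.
    have h2 : -Θ ≤ η * j i := by
      have := mul_le_mul_of_nonneg_left (abs_le.1 h1).1 hη0.le
      have e : η * -N = -Θ := by rw [hη]; field_simp
      linarith
    have h3 : Real.sinh Θ ≤ Real.sinh (2 * Θ + η * j i) := Real.sinh_le_sinh.2 (by linarith)
    have h4 : 0 ≤ Real.sinh Θ := Real.sinh_nonneg_iff.2 hΘ.le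
    gcongr
  have up : ∑' j, (E j * latticeLaplacian v j) ^ 2 ≤
      h ^ 4 * (2 * M ^ 2 * ∑' j, (E j * v j) ^ 2 + 2 * ∑' j, (E j * f j) ^ 2) := by
    have hL : ∀ j, latticeLaplacian v j = h ^ 2 * (f j - V j * v j) := fun j => by
      rw [← hf j, discreteLaplacian_eq]; field_simp; ring
    have sL : Summable fun j => (E j * latticeLaplacian v j) ^ 2 :=
      ((sf fun j => E j ^ 2 * h ^ 4 * (f j - V j * v j)).sub
        (sv fun j => E j ^ 2 * h ^ 4 * (f j - V j * v j) * V j)).congr fun j => by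
          rw [hL]; ring
    rw [← tsum_mul_left, ← tsum_mul_left, ← (sEv.mul_left _).tsum_add (sEf.mul_left _),
      ← tsum_mul_left]
    refine sL.tsum_le_tsum (fun j => ?_) (((sEv.mul_left _).add (sEf.mul_left _)).mul_left _)
    have h1 : V j ^ 2 ≤ M ^ 2 := sq_le_sq' (abs_le.1 (hV j)).1 (abs_le.1 (hV j)).2
    have h2 := mul_le_mul_of_nonneg_right h1 (sq_nonneg (E j * v j))
    rw [hL, show (E j * (h ^ 2 * (f j - V j * v j))) ^ 2 =
      h ^ 4 * (E j * f j - V j * (E j * v j)) ^ 2 by ring]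
    gcongr
    nlinarith [sq_nonneg (E j * f j + V j * (E j * v j))]
  set X := ∑' j, (E j * v j) ^ 2
  set Y := ∑' j, (E j * f j) ^ 2
  have hX : 0 ≤ X := tsum_nonneg fun j => sq_nonneg _
  -- The Carleman bound and `hcond` give `4(M² + 1)X ≤ 2M²X + 2Y`, so the potential term is absorbed
  -- on the left.
  have hXY : X ≤ Y := by
    have hs : 0 ≤ Real.sinh η := Real.sinh_nonneg_iff.2 hη0.le
    have a1 := mul_le_mul_of_nonneg_left low (mul_nonneg (by norm_num : (0 : ℝ) ≤ 8) hs)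
    have a2 := mul_le_mul_of_nonneg_right hcond hX
    have a3 : h ^ 4 * (4 * (M ^ 2 + 1) * X) ≤ h ^ 4 * (2 * M ^ 2 * X + 2 * Y) := by
      refine le_trans ?_ ((a1.trans car).trans up)
      linarith
    have a4 := le_of_mul_le_mul_left a3 (by positivity)
    nlinarith [mul_nonneg (sq_nonneg M) hX]
  have hvX : Real.exp (-(5 * (Θ * N))) * ∑' j, v j ^ 2 ≤ X := by
    rw [← tsum_mul_left]
    refine (sv2.mul_left _).tsum_le_tsum (fun j => ?_) sEv
    by_cases hj : v j = 0
    · simp [hj]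
    have h1 := (abs_le.1 (hψ j (hv0 j hj))).1
    rw [mul_pow, hE]
    simp only
    rw [← Real.exp_nat_mul]
    gcongr
    push_cast
    linarith
  have hfY : Y ≤ Real.exp (5 * (Θ * N)) * ∑' j, f j ^ 2 := by
    rw [← tsum_mul_left]
    refine sEf.tsum_le_tsum (fun j => ?_) (sf2.mul_left _)
    by_cases hj : f j = 0
    · simp [hj]
    have h1 := (abs_le.1 (hψ j (hf0 j hj))).2
    rw [mul_pow, hE]
    simp only
    rw [← Real.exp_nat_mul]
    refine mul_le_mul_of_nonneg_right (Real.exp_le_exp.2 ?_) (sq_nonneg _)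
    push_cast
    linarith
  have h1 := mul_le_mul_of_nonneg_left ((hvX.trans hXY).trans hfY) (Real.exp_pos (5 * (Θ * N))).le
  rw [← mul_assoc (Real.exp _), ← mul_assoc (Real.exp _) (Real.exp _), ← Real.exp_add,
    ← Real.exp_add] at h1
  rw [show 5 * (Θ * N) + -(5 * (Θ * N)) = 0 by ring, Real.exp_zero, one_mul] at h1
  rwa [show 10 * (Θ * N) = 5 * (Θ * N) + 5 * (Θ * N) by ring]

/-- Comparison of the mass in the ball with the mass in the annulus, given a cut-off of `u` whose
equation error is controlled by the annulus. -/
theorem ballMass_le_of_cutoff (i : Fin d) {h R Θ M K : ℝ} (hh : 0 < h) (hR : 0 < R) (hΘ : 0 < Θ)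
    (hcond : h ^ 4 * (M ^ 2 + 1) ≤ 2 * Real.sinh (Θ / ((R + 1) / h)) * Real.sinh Θ ^ 2)
    {V u v : (Fin d → ℤ) → ℝ} (hV : ∀ j, |V j| ≤ M)
    (huv : ∀ j, absPt h j < R - 1 → v j = u j)
    (hv0 : ∀ j, v j ≠ 0 → absPt h j < R + 1)
    (hf0 : ∀ j, discreteLaplacian h v j + V j * v j ≠ 0 → absPt h j < R + 1)
    (hK : ∑' j, (discreteLaplacian h v j + V j * v j) ^ 2 ≤ K * ∑' j, annulusDensity h R u j) :
    ballMass h (R - 1) u ≤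
      Real.exp (10 * (Θ * ((R + 1) / h))) * (K * annulusMass h R u) := by
  have h1 := tsum_sq_le_of_equation i hh hR hΘ hcond hV (fun _ => rfl) hv0 hf0
  have hvs := support_finite_of_absPt_lt hh hv0
  have sv2 : Summable fun j => v j ^ 2 :=
    summable_of_support_finite hvs 0 fun j hj => by simp only [add_zero] at hj; simp [hj]
  have h2 : ∑' j : {j : Fin d → ℤ // absPt h j < R - 1}, |u j| ^ 2 ≤ ∑' j, v j ^ 2 := by
    rw [tsum_congr (fun j : {j : Fin d → ℤ // absPt h j < R - 1} =>
      show |u j| ^ 2 = v j ^ 2 by rw [huv j j.2, sq_abs])]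
    exact sv2.tsum_subtype_le (fun j => v j ^ 2) {j | absPt h j < R - 1} (fun j => sq_nonneg _)
  rw [annulusMass_eq, ballMass]
  have h3 : (0 : ℝ) ≤ h ^ d := by positivity
  calc h ^ d * ∑' j : {j : Fin d → ℤ // absPt h j < R - 1}, |u j| ^ 2
      ≤ h ^ d * (Real.exp (10 * (Θ * ((R + 1) / h))) * (K * ∑' j, annulusDensity h R u j)) := by
        refine mul_le_mul_of_nonneg_left ((h2.trans h1).trans ?_) h3
        exact mul_le_mul_of_nonneg_left hK (Real.exp_pos _).le
    _ = _ := by ring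

end WeightedBound

/-! ### Sharp cut-off for the coarse regime -/

section SharpCutoff

variable {d : ℕ}

lemma sum_sq_le_card_mul (F H : Fin d → ℝ) :
    (∑ k, (F k + H k)) ^ 2 ≤ d * ∑ k, (2 * F k ^ 2 + 2 * H k ^ 2) := by
  have h1 := sq_sum_le_card_mul_sum_sq (s := (univ : Finset (Fin d))) (f := fun k => F k + H k)
  rw [card_univ, Fintype.card_fin] at h1
  refine h1.trans ?_
  gcongr with k
  nlinarith [sq_nonneg (F k - H k)]

/-- Cutting `u` off sharply at radius `R - 1/2` produces an error supported in the annulus. -/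
theorem exists_sharp_cutoff {h R : ℝ} (hh : 0 < h) (hh' : h < 3 / 2) {V u : (Fin d → ℤ) → ℝ}
    (hu : ∀ j, discreteLaplacian h u j + V j * u j = 0) :
    ∃ v : (Fin d → ℤ) → ℝ, (∀ j, absPt h j < R - 1 → v j = u j) ∧
      (∀ j, v j ≠ 0 → absPt h j < R + 1) ∧
      (∀ j, discreteLaplacian h v j + V j * v j ≠ 0 → absPt h j < R + 1) ∧
      ∑' j, (discreteLaplacian h v j + V j * v j) ^ 2 ≤
        4 * d ^ 2 / h ^ 4 * ∑' j, annulusDensity h R u j := by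
  classical
  set v : (Fin d → ℤ) → ℝ := fun j => if absPt h j < R - 1 / 2 then u j else 0 with hvdef
  have vin : ∀ j, absPt h j < R - 1 / 2 → v j = u j := fun j hj => if_pos hj
  have vout : ∀ j, ¬ absPt h j < R - 1 / 2 → v j = 0 := fun j hj => if_neg hj
  set b := annulusDensity h R u with hb
  have b0 : ∀ j, 0 ≤ b j := annulusDensity_nonneg h R u
  -- The radius `R - 1/2` is the middle of the annulus, at distance `3/2` from both ends; `h < 3/2`
  -- keeps every neighbour across the jump inside it.
  have near : ∀ j a : Fin d → ℤ, absPt h j < R - 1 / 2 → |absPt h a - absPt h j| ≤ h →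
      (v a - u a) ^ 2 ≤ b a := fun j a hj ha => by
    by_cases hc : absPt h a < R - 1 / 2
    · simpa [vin a hc] using b0 a
    · rw [vout a hc, hb, annulusDensity_of_mem (by linarith) (by linarith [(abs_le.1 ha).2])]
      simp
  have far : ∀ j a : Fin d → ℤ, ¬ absPt h j < R - 1 / 2 → |absPt h a - absPt h j| ≤ h →
      v a ^ 2 ≤ b a := fun j a hj ha => by
    by_cases hc : absPt h a < R - 1 / 2
    · rw [vin a hc, hb, annulusDensity_of_mem (by linarith [(abs_le.1 ha).1]) (by linarith)]
    · simpa [vout a hc] using b0 a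
  have hp := absPt_add_unitVec_le (d := d) hh
  have hm := absPt_sub_unitVec_le (d := d) hh
  -- Inside the cut, subtracting the equation for `u` leaves only `v - u` at the neighbours;
  -- outside, `v j = 0` leaves only `v` at the neighbours.
  have flap : ∀ j, ∃ F H : Fin d → ℝ,
      latticeLaplacian v j + h ^ 2 * (V j * v j) = ∑ k, (F k + H k) ∧
      (∀ k, F k ^ 2 ≤ b (j + unitVec k)) ∧ ∀ k, H k ^ 2 ≤ b (j - unitVec k) := by
    intro j
    by_cases hj : absPt h j < R - 1 / 2
    · refine ⟨fun k => v (j + unitVec k) - u (j + unitVec k),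
        fun k => v (j - unitVec k) - u (j - unitVec k), ?_,
        fun k => near j _ hj (hp j k), fun k => near j _ hj (hm j k)⟩
      have e := hu j
      rw [discreteLaplacian_eq] at e
      have e' : latticeLaplacian u j + h ^ 2 * (V j * u j) = 0 := by
        field_simp at e; linarith
      rw [vin j hj, ← sub_zero (latticeLaplacian v j + _), ← e', latticeLaplacian,
        latticeLaplacian, add_sub_add_right_eq_sub, ← sum_sub_distrib]
      refine sum_congr rfl fun k _ => ?_
      rw [vin j hj]; ring
    · refine ⟨fun k => v (j + unitVec k), fun k => v (j - unitVec k), ?_,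
        fun k => far j _ hj (hp j k), fun k => far j _ hj (hm j k)⟩
      rw [vout j hj, latticeLaplacian]
      simp [vout j hj]
  have fsq : ∀ j, (discreteLaplacian h v j + V j * v j) ^ 2 ≤
      1 / h ^ 4 * (d * ∑ k, (2 * b (j + unitVec k) + 2 * b (j - unitVec k))) := by
    intro j
    obtain ⟨F, H, e, hF, hH⟩ := flap j
    have e2 : discreteLaplacian h v j + V j * v j = (∑ k, (F k + H k)) / h ^ 2 := by
      rw [← e, discreteLaplacian_eq]; field_simp
    rw [e2, div_pow, ← pow_mul, div_eq_mul_inv, mul_comm, ← one_div]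
    gcongr
    refine (sum_sq_le_card_mul F H).trans ?_
    gcongr with k
    · exact hF k
    · exact hH k
  have hf0 : ∀ j, discreteLaplacian h v j + V j * v j ≠ 0 → absPt h j < R + 1 := by
    intro j hj
    by_contra hc
    refine hj ?_
    rw [discreteLaplacian_eq, latticeLaplacian, vout j (by linarith), sum_eq_zero]
    · simp
    · intro k _
      rw [vout _ (by linarith [(abs_le.1 (hp j k)).1]), vout _ (by linarith [(abs_le.1 (hm j k)).1])]
      ring
  have sb : Summable b := summable_annulusDensity hh R u
  refine ⟨v, fun j hj => vin j (by linarith), fun j hj => ?_, hf0, ?_⟩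
  · by_contra hc
    exact hj (vout j (by linarith))
  · have sk : ∀ k ∈ (univ : Finset (Fin d)), Summable fun j =>
        2 * b (j + unitVec k) + 2 * b (j - unitVec k) := fun k _ =>
      ((summable_comp_add sb _).mul_left 2).add ((summable_comp_sub sb _).mul_left 2)
    have sf : Summable fun j => (discreteLaplacian h v j + V j * v j) ^ 2 :=
      summable_of_support_finite (support_finite_of_absPt_lt hh hf0) 0 fun j hj => by
        rw [add_zero] at hj; rw [hj]; simp
    refine (sf.tsum_le_tsum fsq (((summable_sum sk).mul_left _).mul_left _)).trans ?_
    rw [tsum_mul_left, tsum_mul_left, Summable.tsum_finsetSum sk]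
    have : ∀ k ∈ (univ : Finset (Fin d)),
        ∑' j, (2 * b (j + unitVec k) + 2 * b (j - unitVec k)) = 4 * ∑' j, b j := fun k _ => by
      rw [((summable_comp_add sb _).mul_left 2).tsum_add ((summable_comp_sub sb _).mul_left 2),
        tsum_mul_left, tsum_mul_left, tsum_comp_add b, tsum_comp_sub b]
      ring
    rw [sum_congr rfl this]
    simp
    apply le_of_eq
    field_simp

end SharpCutoff

/-! ### A piecewise cubic step function -/

section Step

/-- Truncation to the unit interval. -/
noncomputable def clamp (t : ℝ) : ℝ := max 0 (min 1 t)

lemma clamp_nonneg (t : ℝ) : 0 ≤ clamp t := le_max_left _ _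

lemma clamp_le_one (t : ℝ) : clamp t ≤ 1 := max_le zero_le_one (min_le_left _ _)

lemma clamp_of_nonpos {t : ℝ} (ht : t ≤ 0) : clamp t = 0 :=
  max_eq_left ((min_le_right _ _).trans ht)

lemma clamp_of_one_le {t : ℝ} (ht : 1 ≤ t) : clamp t = 1 := by
  rw [clamp, min_eq_left ht, max_eq_right zero_le_one]

lemma clamp_of_mem {t : ℝ} (h0 : 0 ≤ t) (h1 : t ≤ 1) : clamp t = t := by
  rw [clamp, min_eq_right h1, max_eq_right h0]

lemma abs_clamp_sub_le (s t : ℝ) : |clamp s - clamp t| ≤ |s - t| := by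
  rw [clamp, clamp, max_comm 0, max_comm 0]
  refine (abs_max_sub_max_le_abs _ _ _).trans ?_
  rw [min_comm 1, min_comm 1]
  have := abs_min_sub_min_le_max s 1 t 1
  simpa using this

/-- A `C^{1,1}` function which is `1` on the negative half-line and `0` on `[1, ∞)`. -/
noncomputable def smoothStep (t : ℝ) : ℝ := 1 - 3 * clamp t ^ 2 + 2 * clamp t ^ 3

lemma smoothStep_of_nonpos {t : ℝ} (ht : t ≤ 0) : smoothStep t = 1 := by
  simp [smoothStep, clamp_of_nonpos ht]

lemma smoothStep_of_one_le {t : ℝ} (ht : 1 ≤ t) : smoothStep t = 0 := by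
  rw [smoothStep, clamp_of_one_le ht]; norm_num

lemma abs_smoothStep_sub_le (s t : ℝ) : |smoothStep s - smoothStep t| ≤ 6 * |s - t| := by
  have e : smoothStep s - smoothStep t = (2 * (clamp s ^ 2 + clamp s * clamp t + clamp t ^ 2) -
      3 * (clamp s + clamp t)) * (clamp s - clamp t) := by
    simp only [smoothStep]; ring
  rw [e, abs_mul]
  refine mul_le_mul ?_ (abs_clamp_sub_le s t) (abs_nonneg _) (by norm_num)
  have a0 := clamp_nonneg s
  have a1 := clamp_le_one s
  have b0 := clamp_nonneg t
  have b1 := clamp_le_one t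
  rw [abs_le]
  constructor <;> nlinarith [mul_nonneg a0 b0, mul_nonneg a0 (sub_nonneg.2 a1),
    mul_nonneg b0 (sub_nonneg.2 b1), mul_nonneg a0 (sub_nonneg.2 b1)]

/-- The coefficient `-6 clamp t (1 - clamp t)` is the derivative at `t`. The cubic remainder in the
clamped variables is exact; the leftover from truncation is tamed because the derivative vanishes at
both ends of the unit interval. -/
lemma abs_smoothStep_taylor_le (s t : ℝ) :
    |smoothStep s - smoothStep t + 6 * clamp t * (1 - clamp t) * (s - t)| ≤ 9 * (s - t) ^ 2 := by
  have e : smoothStep s - smoothStep t + 6 * clamp t * (1 - clamp t) * (s - t) =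
      (2 * clamp s + 4 * clamp t - 3) * (clamp s - clamp t) ^ 2 +
        6 * (clamp t * (1 - clamp t) * ((s - t) - (clamp s - clamp t))) := by
    simp only [smoothStep]; ring
  have h1 : |(2 * clamp s + 4 * clamp t - 3) * (clamp s - clamp t) ^ 2| ≤ 3 * (s - t) ^ 2 := by
    rw [abs_mul, abs_of_nonneg (sq_nonneg (clamp s - clamp t))]
    refine mul_le_mul ?_ (sq_le_sq.2 (abs_clamp_sub_le s t)) (sq_nonneg _) (by norm_num)
    rw [abs_le]
    constructor <;> linarith [clamp_nonneg s, clamp_nonneg t, clamp_le_one s, clamp_le_one t]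
  have h2 : |clamp t * (1 - clamp t) * ((s - t) - (clamp s - clamp t))| ≤ (s - t) ^ 2 := by
    rcases le_total t 0 with ht | ht
    · simpa [clamp_of_nonpos ht] using sq_nonneg (s - t)
    rcases le_total 1 t with ht1 | ht1
    · simpa [clamp_of_one_le ht1] using sq_nonneg (s - t)
    rw [clamp_of_mem ht ht1]
    rcases le_total s 0 with hs | hs
    · rw [clamp_of_nonpos hs, abs_le]
      have := mul_nonneg ht (sub_nonneg.2 ht1)
      constructor <;> nlinarith [mul_nonneg this (neg_nonneg.2 hs), mul_nonneg ht (neg_nonneg.2 hs),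
        mul_nonneg (mul_nonneg ht ht) (neg_nonneg.2 hs)]
    rcases le_total 1 s with hs1 | hs1
    · rw [clamp_of_one_le hs1, abs_le]
      have := mul_nonneg ht (sub_nonneg.2 ht1)
      constructor <;> nlinarith [mul_nonneg this (sub_nonneg.2 hs1),
        mul_nonneg (sub_nonneg.2 ht1) (sub_nonneg.2 hs1),
        mul_nonneg (mul_nonneg (sub_nonneg.2 ht1) (sub_nonneg.2 ht1)) (sub_nonneg.2 hs1)]
    · rw [clamp_of_mem hs hs1]
      simpa using sq_nonneg (s - t)
  rw [e]
  refine (abs_add_le _ _).trans ?_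
  rw [abs_mul 6, abs_of_pos (by norm_num : (0 : ℝ) < 6)]
  linarith

lemma abs_smoothStep_second_difference_le (t a b : ℝ) :
    |smoothStep (t + a) + smoothStep (t - b) - 2 * smoothStep t| ≤
      6 * |a - b| + 9 * (a ^ 2 + b ^ 2) := by
  have h1 := abs_smoothStep_taylor_le (t + a) t
  have h2 := abs_smoothStep_taylor_le (t - b) t
  have h3 : |6 * clamp t * (1 - clamp t) * (a - b)| ≤ 6 * |a - b| := by
    rw [abs_mul]
    refine mul_le_mul_of_nonneg_right ?_ (abs_nonneg _)
    have a0 := clamp_nonneg t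
    have a1 := clamp_le_one t
    rw [abs_le]
    constructor <;> nlinarith [mul_nonneg a0 (sub_nonneg.2 a1)]
  rw [abs_le] at h1 h2 h3 ⊢
  constructor <;> nlinarith

end Step

/-! ### Caccioppoli inequality and smooth cut-off for the fine regime -/

section SmoothCutoff

variable {d : ℕ}

/-- Discrete Caccioppoli inequality. -/
theorem caccioppoli {h M L : ℝ} (hh : 0 < h)
    {V u ζ b : (Fin d → ℤ) → ℝ} (hV : ∀ j, |V j| ≤ M)
    (hu : ∀ j, discreteLaplacian h u j + V j * u j = 0) (hζ : (support ζ).Finite)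
    (hb : Summable b) (hζb : ∀ j, (ζ j * u j) ^ 2 ≤ b j)
    (hedge : ∀ j k, (ζ (j + unitVec k) - ζ j) ^ 2 * (u j * u (j + unitVec k)) ≤
      L * h ^ 2 * ((b j + b (j + unitVec k)) / 2)) :
    ∑ k : Fin d, ∑' j, (ζ (j + unitVec k) * u (j + unitVec k) - ζ j * u j) ^ 2 ≤
      h ^ 2 * (d * L + M) * ∑' j, b j := by
  set P : Fin d → (Fin d → ℤ) → ℝ := fun k j => ζ j ^ 2 * u j * (u (j + unitVec k) - u j) with hP
  set Q : Fin d → (Fin d → ℤ) → ℝ := fun k j => ζ j ^ 2 * u j * (u j - u (j - unitVec k)) with hQ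
  have sζ (K : (Fin d → ℤ) → ℝ) (a : Fin d → ℤ) : Summable fun j => ζ (j + a) * K j :=
    summable_of_support_finite hζ a fun j hj => by simp [hj]
  have sζ0 (K : (Fin d → ℤ) → ℝ) : Summable fun j => ζ j * K j := by simpa using sζ K 0
  have sP : ∀ k, Summable (P k) := fun k =>
    (sζ0 fun j => ζ j * u j * (u (j + unitVec k) - u j)).congr fun j => by simp only [hP]; ring
  have sQ : ∀ k, Summable (Q k) := fun k =>
    (sζ0 fun j => ζ j * u j * (u j - u (j - unitVec k))).congr fun j => by simp only [hQ]; ring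
  have sV : Summable fun j => ζ j ^ 2 * u j * latticeLaplacian u j :=
    (sζ0 fun j => ζ j * u j * latticeLaplacian u j).congr fun j => by ring
  have hL : ∀ j, latticeLaplacian u j = -(h ^ 2 * (V j * u j)) := fun j => by
    have e := hu j
    rw [discreteLaplacian_eq] at e
    field_simp at e
    linarith
  have id1 : ∑ k : Fin d, (∑' j, P k j - ∑' j, Q k j) =
      ∑' j, ζ j ^ 2 * u j * latticeLaplacian u j := by
    rw [sum_congr rfl fun k _ => ((sP k).tsum_sub (sQ k)).symm,
      ← Summable.tsum_finsetSum fun k _ => (sP k).sub (sQ k)]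
    refine tsum_congr fun j => ?_
    rw [latticeLaplacian, mul_sum]
    refine sum_congr rfl fun k _ => ?_
    simp only [hP, hQ]; ring
  -- Discrete product rule, with primes for values at `j + e_k`: `(ζ'u' - ζu)² = ζ'²u'(u' - u) -
  -- ζ²u(u' - u) + (ζ' - ζ)²uu'`. The first two terms are a translate of `Q` and `P`; `hedge`
  -- handles the third.
  have id2 : ∀ k : Fin d, ∑' j, (ζ (j + unitVec k) * u (j + unitVec k) - ζ j * u j) ^ 2 ≤
      ∑' j, Q k j - ∑' j, P k j + L * h ^ 2 * ∑' j, b j := by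
    intro k
    have sg : Summable fun j => (ζ (j + unitVec k) * u (j + unitVec k) - ζ j * u j) ^ 2 :=
      ((sζ (fun j => u (j + unitVec k) *
          (ζ (j + unitVec k) * u (j + unitVec k) - ζ j * u j)) (unitVec k)).sub
        (sζ0 fun j => u j * (ζ (j + unitVec k) * u (j + unitVec k) - ζ j * u j))).congr
        fun j => by ring
    have sb' := summable_comp_add hb (unitVec k)
    have sQ' := summable_comp_add (sQ k) (unitVec k)
    have hs : ∑' j, (b j + b (j + unitVec k)) / 2 = ∑' j, b j := by
      rw [tsum_div_const, hb.tsum_add sb', tsum_comp_add b]; ring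
    rw [← hs, ← tsum_mul_left, ← tsum_comp_add (Q k) (unitVec k), ← sQ'.tsum_sub (sP k),
      ← (sQ'.sub (sP k)).tsum_add (((hb.add sb').div_const 2).mul_left _)]
    refine sg.tsum_le_tsum (fun j => ?_)
      ((sQ'.sub (sP k)).add (((hb.add sb').div_const 2).mul_left _))
    have := hedge j k
    simp only [hP, hQ, add_sub_cancel_right]
    nlinarith
  have h3 : -∑' j, ζ j ^ 2 * u j * latticeLaplacian u j ≤ h ^ 2 * M * ∑' j, b j := by
    rw [← tsum_neg, ← tsum_mul_left]
    refine sV.neg.tsum_le_tsum (fun j => ?_) (hb.mul_left _)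
    have hM : 0 ≤ M := (abs_nonneg _).trans (hV j)
    calc -(ζ j ^ 2 * u j * latticeLaplacian u j) = h ^ 2 * (V j * (ζ j * u j) ^ 2) := by
          rw [hL]; ring
      _ ≤ h ^ 2 * (M * b j) := by
          refine mul_le_mul_of_nonneg_left ?_ (sq_nonneg h)
          exact mul_le_mul ((le_abs_self _).trans (hV j)) (hζb j) (sq_nonneg _) hM
      _ = h ^ 2 * M * b j := by ring
  refine (sum_le_sum fun k _ => id2 k).trans ?_
  rw [sum_add_distrib, sum_const, card_univ, Fintype.card_fin, nsmul_eq_mul]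
  have e : ∑ k : Fin d, (∑' j, Q k j - ∑' j, P k j) =
      -∑' j, ζ j ^ 2 * u j * latticeLaplacian u j := by
    rw [← id1, ← sum_neg_distrib]
    exact sum_congr rfl fun k _ => by ring
  rw [e]
  linarith

lemma absPt_add_unitVec_sq (h : ℝ) (j : Fin d → ℤ) (k : Fin d) :
    absPt h (j + unitVec k) ^ 2 = absPt h j ^ 2 + (2 * h * (h * j k) + h ^ 2) := by
  rw [absPt_sq, absPt_sq, ← add_sum_erase univ _ (mem_univ k),
    ← add_sum_erase univ (fun l => (h * (j l : ℝ)) ^ 2) (mem_univ k)]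
  have : ∑ l ∈ univ.erase k, (h * ((j + unitVec k) l : ℝ)) ^ 2 =
      ∑ l ∈ univ.erase k, (h * (j l : ℝ)) ^ 2 := sum_congr rfl fun l hl => by
    rw [Pi.add_apply, unitVec_of_ne (ne_of_mem_erase hl).symm, add_zero]
  rw [this, Pi.add_apply, unitVec_same]
  push_cast; ring

lemma absPt_sub_unitVec_sq (h : ℝ) (j : Fin d → ℤ) (k : Fin d) :
    absPt h (j - unitVec k) ^ 2 = absPt h j ^ 2 - (2 * h * (h * j k) - h ^ 2) := by
  have e := absPt_add_unitVec_sq h (j - unitVec k) k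
  rw [sub_add_cancel, Pi.sub_apply, unitVec_same] at e
  push_cast at e
  linarith

/-- The radial cut-off at radius about `R`. -/
noncomputable def radialCutoff (h R : ℝ) (j : Fin d → ℤ) : ℝ :=
  smoothStep ((absPt h j ^ 2 - (R - 1) ^ 2) / R)

lemma radialCutoff_eq_one {h R : ℝ} (hR : 0 < R) {j : Fin d → ℤ} (hj : absPt h j ≤ R - 1) :
    radialCutoff h R j = 1 := by
  refine smoothStep_of_nonpos (div_nonpos_of_nonpos_of_nonneg ?_ hR.le)
  nlinarith [absPt_nonneg h j]

lemma radialCutoff_eq_zero {h R : ℝ} (hR : 1 ≤ R) {j : Fin d → ℤ} (hj : R ≤ absPt h j) :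
    radialCutoff h R j = 0 := by
  refine smoothStep_of_one_le ((one_le_div (by linarith)).2 ?_)
  nlinarith [absPt_nonneg h j]

/-- The cut-off is a function of `|x|²` because its increments `±2h x_k + h²` are explicit. After
division by `R` they are at most `3h` in size and nearly opposite, so the second difference is at
most `6h² + 9·18h² = 168h²`. -/
lemma radialCutoff_differences {h R : ℝ} (hh : 0 < h) (hh' : h ≤ 1 / 10) (hR : 10 ≤ R)
    {j : Fin d → ℤ} (hj : absPt h j ≤ R + 1) (k : Fin d) :
    |radialCutoff h R (j + unitVec k) - radialCutoff h R j| ≤ 170 * h ∧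
    |radialCutoff h R (j - unitVec k) - radialCutoff h R j| ≤ 170 * h ∧
    |radialCutoff h R (j + unitVec k) + radialCutoff h R (j - unitVec k) -
      2 * radialCutoff h R j| ≤ 170 * h ^ 2 := by
  have hR0 : 0 < R := by linarith
  set t := (absPt h j ^ 2 - (R - 1) ^ 2) / R with ht
  set a := (2 * h * (h * j k) + h ^ 2) / R with ha
  set b := (2 * h * (h * j k) - h ^ 2) / R with hb
  have e0 : radialCutoff h R j = smoothStep t := rfl
  have e1 : radialCutoff h R (j + unitVec k) = smoothStep (t + a) := by
    rw [radialCutoff, absPt_add_unitVec_sq, ht, ha]; congr 1; ring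
  have e2 : radialCutoff h R (j - unitVec k) = smoothStep (t - b) := by
    rw [radialCutoff, absPt_sub_unitVec_sq, ht, hb]; congr 1; ring
  have hy := abs_le.1 ((abs_coord_le_absPt h j k).trans hj)
  have p1 := mul_le_mul_of_nonneg_left hy.1 hh.le
  have p2 := mul_le_mul_of_nonneg_left hy.2 hh.le
  have p3 := mul_le_mul_of_nonneg_left hh' hh.le
  have p4 := mul_le_mul_of_nonneg_left hR hh.le
  have a3 : |a| ≤ 3 * h := by
    rw [ha, abs_div, abs_of_pos hR0, div_le_iff₀ hR0, abs_le]
    constructor <;> nlinarith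
  have b3 : |b| ≤ 3 * h := by
    rw [hb, abs_div, abs_of_pos hR0, div_le_iff₀ hR0, abs_le]
    constructor <;> nlinarith
  have ab : |a - b| ≤ h ^ 2 := by
    have : a - b = 2 * h ^ 2 / R := by rw [ha, hb]; ring
    rw [this, abs_of_nonneg (by positivity), div_le_iff₀ hR0]
    nlinarith [sq_nonneg h]
  have a4 : a ^ 2 ≤ (3 * h) ^ 2 := sq_le_sq' (abs_le.1 a3).1 (abs_le.1 a3).2
  have b4 : b ^ 2 ≤ (3 * h) ^ 2 := sq_le_sq' (abs_le.1 b3).1 (abs_le.1 b3).2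
  rw [e0, e1, e2]
  refine ⟨(abs_smoothStep_sub_le _ _).trans ?_, (abs_smoothStep_sub_le _ _).trans ?_,
    (abs_smoothStep_second_difference_le t a b).trans ?_⟩
  · rw [add_sub_cancel_left]; linarith
  · rw [sub_sub_cancel_left, abs_neg]; linarith
  · nlinarith [sq_nonneg h]

/-- The cut-off to a neighbourhood of the transition region of `radialCutoff`. -/
noncomputable def annularCutoff (h R : ℝ) (j : Fin d → ℤ) : ℝ :=
  clamp (4 - 3 * |absPt h j - (R - 1 / 2)|)

lemma annularCutoff_eq_one {h R : ℝ} {j : Fin d → ℤ} (hj : |absPt h j - (R - 1 / 2)| ≤ 1) :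
    annularCutoff h R j = 1 := clamp_of_one_le (by linarith)

lemma annularCutoff_eq_zero {h R : ℝ} {j : Fin d → ℤ} (hj : 4 / 3 ≤ |absPt h j - (R - 1 / 2)|) :
    annularCutoff h R j = 0 := clamp_of_nonpos (by linarith)

lemma annulusDensity_of_abs_lt {h R : ℝ} {u : (Fin d → ℤ) → ℝ} {j : Fin d → ℤ}
    (hj : |absPt h j - (R - 1 / 2)| < 3 / 2) : annulusDensity h R u j = u j ^ 2 :=
  annulusDensity_of_mem (by linarith [(abs_lt.1 hj).1]) (by linarith [(abs_lt.1 hj).2])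

/-- The cut-off has slope `3`, whence the `9`. Its support has half-width `4/3`, and one step of `h
≤ 1/10` stays within the half-width `3/2` of the annulus. -/
theorem caccioppoli_annulus {h R M : ℝ} (hh : 0 < h) (hh' : h ≤ 1 / 10)
    {V u : (Fin d → ℤ) → ℝ} (hV : ∀ j, |V j| ≤ M)
    (hu : ∀ j, discreteLaplacian h u j + V j * u j = 0) :
    ∑ k : Fin d, ∑' j, (annularCutoff h R (j + unitVec k) * u (j + unitVec k) -
        annularCutoff h R j * u j) ^ 2 ≤
      h ^ 2 * (d * 9 + M) * ∑' j, annulusDensity h R u j := by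
  have near : ∀ j : Fin d → ℤ, annularCutoff h R j ≠ 0 → |absPt h j - (R - 1 / 2)| < 4 / 3 :=
    fun j hj => by
      by_contra hc
      exact hj (annularCutoff_eq_zero (not_lt.1 hc))
  refine caccioppoli hh hV hu ?_ (summable_annulusDensity hh R u) (fun j => ?_) fun j k => ?_
  · exact support_finite_of_absPt_lt hh (r := R + 1) fun j hj => by
      linarith [(abs_lt.1 (near j hj)).2]
  · by_cases hj : annularCutoff h R j = 0
    · simpa [hj] using annulusDensity_nonneg h R u j
    · rw [annulusDensity_of_abs_lt ((near j hj).trans (by norm_num)), mul_pow]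
      refine mul_le_of_le_one_left (sq_nonneg _) ?_
      exact pow_le_one₀ (clamp_nonneg _) (clamp_le_one _)
  · have hp := absPt_add_unitVec_le hh j k
    have hd1 : ∀ x y : ℝ, |x - y| ≤ h → |y - (R - 1 / 2)| ≤ |x - (R - 1 / 2)| + h := by
      intro x y hxy
      have := abs_sub_le y x (R - 1 / 2)
      rw [abs_sub_comm y x] at this
      linarith
    by_cases hj : annularCutoff h R j = 0 ∧ annularCutoff h R (j + unitVec k) = 0
    · rw [hj.1, hj.2]
      have := annulusDensity_nonneg h R u j
      have := annulusDensity_nonneg h R u (j + unitVec k)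
      simp only [sub_self, ne_eq, OfNat.ofNat_ne_zero, not_false_eq_true, zero_pow, zero_mul]
      positivity
    · have hp' : |absPt h j - absPt h (j + unitVec k)| ≤ h := by rwa [abs_sub_comm]
      have both : |absPt h j - (R - 1 / 2)| < 3 / 2 ∧
          |absPt h (j + unitVec k) - (R - 1 / 2)| < 3 / 2 := by
        rcases not_and_or.1 hj with h1 | h1
        · have := near _ h1
          exact ⟨by linarith, by linarith [hd1 _ _ hp']⟩
        · have := near _ h1
          exact ⟨by linarith [hd1 _ _ hp], by linarith⟩
      rw [annulusDensity_of_abs_lt both.1, annulusDensity_of_abs_lt both.2]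
      have lip : |annularCutoff h R (j + unitVec k) - annularCutoff h R j| ≤ 3 * h := by
        refine (abs_clamp_sub_le _ _).trans ?_
        rw [abs_le]
        constructor <;> linarith [hd1 _ _ hp, hd1 _ _ hp']
      have lip2 := sq_le_sq' (abs_le.1 lip).1 (abs_le.1 lip).2
      calc _ ≤ (annularCutoff h R (j + unitVec k) - annularCutoff h R j) ^ 2 *
            ((u j ^ 2 + u (j + unitVec k) ^ 2) / 2) := by
            gcongr
            nlinarith [sq_nonneg (u j - u (j + unitVec k))]
        _ ≤ (3 * h) ^ 2 * ((u j ^ 2 + u (j + unitVec k) ^ 2) / 2) := by gcongr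
        _ = _ := by ring

/-- Cutting `u` off smoothly near radius `R` produces an error controlled by the annulus,
uniformly in the mesh size. -/
theorem exists_smooth_cutoff {h R M : ℝ} (hh : 0 < h) (hh' : h ≤ 1 / 10) (hR : 10 ≤ R)
    {V u : (Fin d → ℤ) → ℝ} (hV : ∀ j, |V j| ≤ M)
    (hu : ∀ j, discreteLaplacian h u j + V j * u j = 0) :
    ∃ v : (Fin d → ℤ) → ℝ, (∀ j, absPt h j < R - 1 → v j = u j) ∧
      (∀ j, v j ≠ 0 → absPt h j < R + 1) ∧
      (∀ j, discreteLaplacian h v j + V j * v j ≠ 0 → absPt h j < R + 1) ∧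
      ∑' j, (discreteLaplacian h v j + V j * v j) ^ 2 ≤
        86700 * d * (19 * d + 2 * M) * ∑' j, annulusDensity h R u j := by
  set χ : (Fin d → ℤ) → ℝ := radialCutoff h R with hχ
  set g : (Fin d → ℤ) → ℝ := fun j => annularCutoff h R j * u j with hg
  set b := annulusDensity h R u with hb
  set v : (Fin d → ℤ) → ℝ := fun j => χ j * u j with hv
  have b0 : ∀ j, 0 ≤ b j := annulusDensity_nonneg h R u
  have hp := absPt_add_unitVec_le (d := d) hh
  have hm := absPt_sub_unitVec_le (d := d) hh
  -- The commutator of the Laplacian with `χ`: since `u` is a solution, the error of `v = χu`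
  -- contains only differences of `χ`.
  set T : Fin d → (Fin d → ℤ) → ℝ := fun k j =>
    (χ (j + unitVec k) - χ j) * (u (j + unitVec k) - u j) +
      (χ (j - unitVec k) - χ j) * (u (j - unitVec k) - u j) +
      (χ (j + unitVec k) + χ (j - unitVec k) - 2 * χ j) * u j with hT
  have fT : ∀ j, discreteLaplacian h v j + V j * v j = (∑ k, T k j) / h ^ 2 := by
    intro j
    have e := hu j
    rw [discreteLaplacian_eq] at e ⊢
    have e' : V j * v j = -(χ j * latticeLaplacian u j) / h ^ 2 := by
      have : V j * u j = -(latticeLaplacian u j / h ^ 2) := by linarith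
      simp only [hv]
      linear_combination χ j * this
    rw [e', ← add_div, latticeLaplacian, latticeLaplacian, mul_sum, ← sub_eq_add_neg,
      ← sum_sub_distrib]
    congr 1
    refine sum_congr rfl fun k _ => ?_
    simp only [hT, hv]; ring
  have Tzero : ∀ k j, R + 2 / 5 < absPt h j → T k j = 0 := by
    intro k j hj
    have z0 : χ j = 0 := radialCutoff_eq_zero (by linarith) (by linarith)
    have z1 : χ (j + unitVec k) = 0 :=
      radialCutoff_eq_zero (by linarith) (by linarith [(abs_le.1 (hp j k)).1])
    have z2 : χ (j - unitVec k) = 0 :=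
      radialCutoff_eq_zero (by linarith) (by linarith [(abs_le.1 (hm j k)).1])
    simp [hT, z0, z1, z2]
  have Tzero' : ∀ k j, absPt h j < R - 7 / 5 → T k j = 0 := by
    intro k j hj
    have z0 : χ j = 1 := radialCutoff_eq_one (by linarith) (by linarith)
    have z1 : χ (j + unitVec k) = 1 :=
      radialCutoff_eq_one (by linarith) (by linarith [(abs_le.1 (hp j k)).2])
    have z2 : χ (j - unitVec k) = 1 :=
      radialCutoff_eq_one (by linarith) (by linarith [(abs_le.1 (hm j k)).2])
    simp only [hT, z0, z1, z2]; ring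
  -- Between `R - 7/5` and `R + 2/5` a point and its neighbours lie where the annular cut-off is
  -- `1`, so `g` may replace `u`. The constant is `3 · 170²`.
  have Tsq : ∀ k j, T k j ^ 2 ≤ 86700 * h ^ 2 * ((g (j + unitVec k) - g j) ^ 2 +
      (g (j - unitVec k) - g j) ^ 2 + h ^ 2 * b j) := by
    intro k j
    have pos : 0 ≤ 86700 * h ^ 2 * ((g (j + unitVec k) - g j) ^ 2 +
      (g (j - unitVec k) - g j) ^ 2 + h ^ 2 * b j) := by have := b0 j; positivity
    by_cases h1 : R + 2 / 5 < absPt h j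
    · rw [Tzero k j h1]; simpa using pos
    by_cases h2 : absPt h j < R - 7 / 5
    · rw [Tzero' k j h2]; simpa using pos
    rw [not_lt] at h1 h2
    have q1 := abs_le.1 (hp j k)
    have q2 := abs_le.1 (hm j k)
    have g0 : g j = u j := by
      simp only [hg]
      rw [annularCutoff_eq_one (by rw [abs_le]; constructor <;> linarith), one_mul]
    have g1 : g (j + unitVec k) = u (j + unitVec k) := by
      simp only [hg]
      rw [annularCutoff_eq_one (by rw [abs_le]; constructor <;> linarith), one_mul]
    have g2 : g (j - unitVec k) = u (j - unitVec k) := by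
      simp only [hg]
      rw [annularCutoff_eq_one (by rw [abs_le]; constructor <;> linarith), one_mul]
    have hbj : b j = u j ^ 2 :=
      annulusDensity_of_abs_lt (by rw [abs_lt]; constructor <;> linarith)
    obtain ⟨d1, d2, d3⟩ := radialCutoff_differences hh hh' hR (j := j) (by linarith) k
    have s1 := sq_le_sq' (abs_le.1 d1).1 (abs_le.1 d1).2
    have s2 := sq_le_sq' (abs_le.1 d2).1 (abs_le.1 d2).2
    have s3 := sq_le_sq' (abs_le.1 d3).1 (abs_le.1 d3).2
    rw [g0, g1, g2, hbj]
    have t1 := mul_le_mul_of_nonneg_right s1 (sq_nonneg (u (j + unitVec k) - u j))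
    have t2 := mul_le_mul_of_nonneg_right s2 (sq_nonneg (u (j - unitVec k) - u j))
    have t3 := mul_le_mul_of_nonneg_right s3 (sq_nonneg (u j))
    have three : ∀ x y z : ℝ, (x + y + z) ^ 2 ≤ 3 * (x ^ 2 + y ^ 2 + z ^ 2) := fun x y z => by
      nlinarith [sq_nonneg (x - y), sq_nonneg (y - z), sq_nonneg (x - z)]
    refine (three _ _ _).trans ?_
    rw [mul_pow, mul_pow, mul_pow]
    linarith
  have hf0 : ∀ j, discreteLaplacian h v j + V j * v j ≠ 0 → absPt h j < R + 1 := by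
    intro j hj
    by_contra hc
    refine hj ?_
    rw [fT, sum_eq_zero fun k _ => Tzero k j (by linarith), zero_div]
  have sb : Summable b := summable_annulusDensity hh R u
  refine ⟨v, fun j hj => ?_, fun j hj => ?_, hf0, ?_⟩
  · simp only [hv, hχ]
    rw [radialCutoff_eq_one (by linarith) hj.le, one_mul]
  · by_contra hc
    refine hj ?_
    simp only [hv, hχ]
    rw [radialCutoff_eq_zero (by linarith) (by linarith), zero_mul]
  have cac := caccioppoli_annulus (R := R) hh hh' hV hu
  have gs : (support g).Finite := support_finite_of_absPt_lt hh (r := R + 1) fun j hj => by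
    by_contra hc
    refine hj ?_
    simp only [hg]
    rw [annularCutoff_eq_zero (by rw [le_abs]; left; linarith), zero_mul]
  have sg : ∀ k, Summable fun j => (g (j + unitVec k) - g j) ^ 2 := fun k => by
    have s1 : Summable fun j => g (j + unitVec k) * (g (j + unitVec k) - g j) :=
      summable_of_support_finite gs (unitVec k) fun j hj => by simp [hj]
    have s2 : Summable fun j => g j * (g (j + unitVec k) - g j) :=
      summable_of_support_finite gs 0 fun j hj => by rw [add_zero] at hj; simp [hj]
    exact (s1.sub s2).congr fun j => by ring
  have eg : ∀ k j, (g (j - unitVec k) - g j) ^ 2 =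
      (fun j => (g (j + unitVec k) - g j) ^ 2) (j - unitVec k) := fun k j => by
    simp only [sub_add_cancel]; ring
  have sg' : ∀ k, Summable fun j => (g (j - unitVec k) - g j) ^ 2 := fun k =>
    (summable_comp_sub (sg k) (unitVec k)).congr fun j => (eg k j).symm
  have tg' : ∀ k, ∑' j, (g (j - unitVec k) - g j) ^ 2 = ∑' j, (g (j + unitVec k) - g j) ^ 2 :=
    fun k => by 
      rw [tsum_congr (eg k), tsum_comp_sub fun j => (g (j + unitVec k) - g j) ^ 2]
  have sf : Summable fun j => (discreteLaplacian h v j + V j * v j) ^ 2 :=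
    summable_of_support_finite (support_finite_of_absPt_lt hh hf0) 0 fun j hj => by
      rw [add_zero] at hj; rw [hj]; simp
  have sT : ∀ k ∈ (univ : Finset (Fin d)), Summable fun j =>
      (g (j + unitVec k) - g j) ^ 2 + (g (j - unitVec k) - g j) ^ 2 + h ^ 2 * b j :=
    fun k _ => ((sg k).add (sg' k)).add (sb.mul_left _)
  have fsq : ∀ j, (discreteLaplacian h v j + V j * v j) ^ 2 ≤
      86700 * d / h ^ 2 * ∑ k, ((g (j + unitVec k) - g j) ^ 2 +
        (g (j - unitVec k) - g j) ^ 2 + h ^ 2 * b j) := by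
    intro j
    rw [fT, div_pow, ← pow_mul, div_le_iff₀ (by positivity)]
    have h1 := sq_sum_le_card_mul_sum_sq (s := (univ : Finset (Fin d))) (f := fun k => T k j)
    rw [card_univ, Fintype.card_fin] at h1
    have h2 := sum_le_sum fun k (_ : k ∈ (univ : Finset (Fin d))) => Tsq k j
    rw [← mul_sum] at h2
    refine (h1.trans (mul_le_mul_of_nonneg_left h2 (Nat.cast_nonneg d))).trans (le_of_eq ?_)
    field_simp
    ring
  refine (sf.tsum_le_tsum fsq ((summable_sum sT).mul_left _)).trans ?_
  rw [tsum_mul_left, Summable.tsum_finsetSum sT]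
  have each : ∀ k ∈ (univ : Finset (Fin d)), ∑' j, ((g (j + unitVec k) - g j) ^ 2 +
      (g (j - unitVec k) - g j) ^ 2 + h ^ 2 * b j) =
      2 * ∑' j, (g (j + unitVec k) - g j) ^ 2 + h ^ 2 * ∑' j, b j := fun k _ => by
    rw [((sg k).add (sg' k)).tsum_add (sb.mul_left _), (sg k).tsum_add (sg' k), tg',
      tsum_mul_left]
    ring
  rw [sum_congr rfl each, sum_add_distrib, ← mul_sum, sum_const, card_univ, Fintype.card_fin,
    nsmul_eq_mul]
  calc 86700 * d / h ^ 2 * (2 * ∑ k, ∑' j, (g (j + unitVec k) - g j) ^ 2 +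
        d * (h ^ 2 * ∑' j, b j))
      ≤ 86700 * d / h ^ 2 * (2 * (h ^ 2 * (d * 9 + M) * ∑' j, b j) +
        d * (h ^ 2 * ∑' j, b j)) := by gcongr
    _ = _ := by field_simp; ring

end SmoothCutoff

/-! ### Choice of `Θ` and the two lower bounds -/

section LowerBounds

variable {d : ℕ}

lemma exp_neg_le_of_le {a b c K A : ℝ} (hc : 0 < c) (hK : 0 < K) (h : c ≤ Real.exp a * (K * A))
    (hb : K / c ≤ Real.exp b) : Real.exp (-(a + b)) ≤ A := by
  have ha := Real.exp_pos a
  have h1 : K ≤ Real.exp b * c := (div_le_iff₀ hc).1 hb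
  have h2 : K * 1 ≤ K * (Real.exp (a + b) * A) := by
    calc K * 1 ≤ Real.exp b * c := by linarith
      _ ≤ Real.exp b * (Real.exp a * (K * A)) := by gcongr
      _ = _ := by rw [Real.exp_add]; ring
  have h3 := le_of_mul_le_mul_left h2 hK
  rw [Real.exp_neg, inv_le_iff_one_le_mul₀ (Real.exp_pos _), mul_comm]
  exact h3

/-- Take `Θ = κ h (R + 1)^{1/3}` with `κ = M² + 1`. Then `sinh x ≥ x` gives `2κ³h⁴` in the
absorption condition, and `ΘN = κ(R + 1)^{4/3} ≤ 4κR^{4/3}`. The constant `41` is `10 · 4` plus `1`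
for absorbing `K / c`; `R ≥ 1000` forces `h ≤ 1/10`. -/
theorem annulusMass_lower_bound_fine (i : Fin d) (M : ℝ) {c : ℝ} (hc : 0 < c) {h R : ℝ}
    (hh : 0 < h) (hR : 1000 + |86700 * d * (19 * d + 2 * M)| / c ≤ R)
    (hhR : h * R ^ (1 / 3 : ℝ) ≤ 1) {V u : (Fin d → ℤ) → ℝ} (hV : ∀ j, |V j| ≤ M)
    (hu : ∀ j, discreteLaplacian h u j + V j * u j = 0) (hB : c ≤ ballMass h (R - 1) u) :
    Real.exp (-(41 * (M ^ 2 + 1)) * R ^ (4 / 3 : ℝ)) ≤ annulusMass h R u := by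
  have hM : 0 ≤ M := (abs_nonneg _).trans (hV 0)
  have hd : (0 : ℝ) < d := Nat.cast_pos.2 (Fin.pos i)
  set K := 86700 * (d : ℝ) * (19 * d + 2 * M) with hKdef
  have hK : 0 < K := by positivity
  rw [abs_of_pos hK] at hR
  have hKc : 0 < K / c := by positivity
  have hR0 : 0 < R := by linarith
  have hq : (10 : ℝ) ≤ R ^ (1 / 3 : ℝ) := by
    calc (10 : ℝ) = ((10 : ℝ) ^ (3 : ℝ)) ^ (1 / 3 : ℝ) := by
          rw [← Real.rpow_mul (by norm_num)]; norm_num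
      _ ≤ R ^ (1 / 3 : ℝ) := by
          refine Real.rpow_le_rpow (by positivity) ?_ (by norm_num)
          norm_num
          linarith
  have hh' : h ≤ 1 / 10 := by nlinarith
  obtain ⟨v, h1, h2, h3, h4⟩ := exists_smooth_cutoff hh hh' (by linarith) hV hu (R := R)
  set κ := M ^ 2 + 1 with hκ
  have hκ1 : 1 ≤ κ := by nlinarith [sq_nonneg M]
  set r := (R + 1) ^ (1 / 3 : ℝ) with hr
  have hr0 : 0 < r := Real.rpow_pos_of_pos (by linarith) _
  have hr3 : r ^ 3 = R + 1 := by
    rw [hr, ← Real.rpow_natCast, ← Real.rpow_mul (by linarith)]; norm_num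
  have hΘ : 0 < κ * h * r := by positivity
  have hcond : h ^ 4 * (M ^ 2 + 1) ≤
      2 * Real.sinh (κ * h * r / ((R + 1) / h)) * Real.sinh (κ * h * r) ^ 2 := by
    have e : κ * h * r / ((R + 1) / h) = κ * h ^ 2 / r ^ 2 := by
      rw [← hr3]; field_simp
    have s1 : κ * h ^ 2 / r ^ 2 ≤ Real.sinh (κ * h ^ 2 / r ^ 2) :=
      Real.self_le_sinh_iff.2 (by positivity)
    have s2 : κ * h * r ≤ Real.sinh (κ * h * r) := Real.self_le_sinh_iff.2 hΘ.le
    rw [e, ← hκ]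
    calc h ^ 4 * κ ≤ h ^ 4 * (2 * κ ^ 3) := by
          gcongr
          nlinarith [one_le_pow₀ hκ1 (n := 2)]
      _ = 2 * (κ * h ^ 2 / r ^ 2) * (κ * h * r) ^ 2 := by field_simp
      _ ≤ _ := by
          have := s1.trans' (show 0 ≤ κ * h ^ 2 / r ^ 2 by positivity)
          gcongr
  have main := ballMass_le_of_cutoff i hh hR0 hΘ hcond hV h1 h2 h3 h4
  have hX : (R + 1) ^ (4 / 3 : ℝ) ≤ 4 * R ^ (4 / 3 : ℝ) := by
    calc (R + 1) ^ (4 / 3 : ℝ) ≤ (2 * R) ^ (4 / 3 : ℝ) :=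
          Real.rpow_le_rpow (by linarith) (by linarith) (by norm_num)
      _ = 2 ^ (4 / 3 : ℝ) * R ^ (4 / 3 : ℝ) := Real.mul_rpow (by norm_num) hR0.le
      _ ≤ 4 * R ^ (4 / 3 : ℝ) := by
          gcongr
          calc (2 : ℝ) ^ (4 / 3 : ℝ) ≤ 2 ^ (2 : ℝ) :=
                Real.rpow_le_rpow_of_exponent_le (by norm_num) (by norm_num)
            _ = 4 := by norm_num
  have hr4 : κ * h * r * ((R + 1) / h) = κ * (R + 1) ^ (4 / 3 : ℝ) := by
    have : (R + 1) ^ (4 / 3 : ℝ) = (R + 1) * r := by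
      rw [hr, ← Real.rpow_one_add' (by linarith) (by norm_num)]; norm_num
    rw [this]; field_simp
  have hRX : R ≤ R ^ (4 / 3 : ℝ) := by
    calc R = R ^ (1 : ℝ) := (Real.rpow_one R).symm
      _ ≤ R ^ (4 / 3 : ℝ) := Real.rpow_le_rpow_of_exponent_le (by linarith) (by norm_num)
  set X := R ^ (4 / 3 : ℝ)
  have hb : K / c ≤ Real.exp (κ * X) := by
    have := Real.add_one_le_exp (κ * X)
    nlinarith
  refine le_trans (Real.exp_le_exp.2 ?_) (exp_neg_le_of_le hc hK (hB.trans main) hb)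
  rw [hr4]
  nlinarith

/-- Take `Θ = log(Rh)`, so that `sinh Θ ≥ Rh/4` and `sinh(Θ/N) ≥ h/(2R)`. The absorption condition
reduces to `16h(M² + 1) ≤ R`, which explains the `24` in view of `h < 3/2`. -/
theorem annulusMass_lower_bound_coarse (i : Fin d) (M : ℝ) {c : ℝ} (hc : 0 < c) {h R : ℝ}
    (hh : 0 < h) (hh' : h < 3 / 2) (hR : (3 + 18 * d ^ 2 / c) ^ 3 + 24 * (M ^ 2 + 1) ≤ R)
    (hhR : 1 < h * R ^ (1 / 3 : ℝ)) {V u : (Fin d → ℤ) → ℝ} (hV : ∀ j, |V j| ≤ M)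
    (hu : ∀ j, discreteLaplacian h u j + V j * u j = 0) (hB : c ≤ ballMass h (R - 1) u) :
    Real.exp (-21 * (R / h) * Real.log (R * h)) ≤ annulusMass h R u := by
  have hd : (0 : ℝ) < d := Nat.cast_pos.2 (Fin.pos i)
  have hM2 := sq_nonneg M
  set p := 3 + 18 * (d : ℝ) ^ 2 / c with hp
  have hdc : 0 ≤ 18 * (d : ℝ) ^ 2 / c := by positivity
  have hp3 : 3 ≤ p := by linarith
  have hp0 : (0 : ℝ) < p ^ 3 := by positivity
  have hR0 : 0 < R := by linarith
  set q := R ^ (1 / 3 : ℝ) with hq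
  have hq0 : 0 < q := Real.rpow_pos_of_pos hR0 _
  have hq3 : q ^ 3 = R := by
    rw [hq, ← Real.rpow_natCast, ← Real.rpow_mul hR0.le]; norm_num
  have hpq : p ≤ q := by
    refine le_of_pow_le_pow_left₀ (n := 3) (by norm_num) hq0.le ?_
    rw [hq3]; linarith
  have hRh : 9 ≤ R * h := by
    have : R * h = q ^ 2 * (h * q) := by rw [← hq3]; ring
    rw [this]
    nlinarith
  have hlog : 1 ≤ Real.log (R * h) := by
    rw [Real.le_log_iff_exp_le (by linarith)]
    linarith [Real.exp_one_lt_d9]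
  have hcond : h ^ 4 * (M ^ 2 + 1) ≤ 2 * Real.sinh (Real.log (R * h) / ((R + 1) / h)) *
      Real.sinh (Real.log (R * h)) ^ 2 := by
    have s1 : h / (2 * R) ≤ Real.sinh (Real.log (R * h) / ((R + 1) / h)) := by
      refine le_trans ?_ (Real.self_le_sinh_iff.2 (by positivity))
      rw [div_div_eq_mul_div, div_le_div_iff₀ (by positivity) (by positivity)]
      have : h * (R + 1) ≤ h * (2 * R) := by gcongr; linarith
      have : 1 * (h * (2 * R)) ≤ Real.log (R * h) * (h * (2 * R)) := by gcongr
      linarith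
    have s2 : R * h / 4 ≤ Real.sinh (Real.log (R * h)) := by
      rw [Real.sinh_log (by linarith)]
      have : (R * h)⁻¹ ≤ 1 := inv_le_one_of_one_le₀ (by linarith)
      linarith
    calc h ^ 4 * (M ^ 2 + 1) = h ^ 3 * (h * (M ^ 2 + 1)) := by ring
      _ ≤ h ^ 3 * (R / 16) := by
          gcongr
          nlinarith
      _ = 2 * (h / (2 * R)) * (R * h / 4) ^ 2 := by field_simp; norm_num
      _ ≤ _ := by
          have := s1.trans' (show 0 ≤ h / (2 * R) by positivity)
          gcongr
  obtain ⟨v, h1, h2, h3, h4⟩ := exists_sharp_cutoff hh hh' hu (R := R)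
  have main := ballMass_le_of_cutoff i hh hR0 (by linarith) hcond hV h1 h2 h3 h4
  set Y := R / h * Real.log (R * h) with hY
  have hRh' : 2 / 3 * q ^ 3 ≤ R / h := by
    rw [hq3, le_div_iff₀ hh]; nlinarith
  have hYq : 2 / 3 * q ^ 3 ≤ Y := by
    have : R / h * 1 ≤ R / h * Real.log (R * h) := by gcongr
    linarith
  -- As `1/h < q`, the cut-off cost is at most of order `q⁴`; `18d²/c ≤ q²` raises this to `(2/9)
  -- q⁶`, which is the quadratic term of `exp((2/3) q³)`.
  have hb : 4 * (d : ℝ) ^ 2 / h ^ 4 / c ≤ Real.exp Y := by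
    have e1 : 1 / h ^ 4 ≤ q ^ 4 := by
      rw [div_le_iff₀ (by positivity), ← mul_pow, mul_comm]
      exact one_le_pow₀ hhR.le
    have e2 := Real.quadratic_le_exp_of_nonneg (show (0 : ℝ) ≤ 2 / 3 * q ^ 3 by positivity)
    have e3 : 18 * (d : ℝ) ^ 2 / c ≤ q ^ 2 := by nlinarith
    calc 4 * (d : ℝ) ^ 2 / h ^ 4 / c = 2 / 9 * (18 * (d : ℝ) ^ 2 / c) * (1 / h ^ 4) := by
          field_simp; norm_num
      _ ≤ 2 / 9 * q ^ 2 * q ^ 4 := by gcongr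
      _ = (2 / 3 * q ^ 3) ^ 2 / 2 := by ring
      _ ≤ Real.exp (2 / 3 * q ^ 3) := by linarith [show (0 : ℝ) ≤ 2 / 3 * q ^ 3 by positivity]
      _ ≤ Real.exp Y := Real.exp_le_exp.2 hYq
  -- The constant `21` is `10 · 2`, from `R + 1 ≤ 2R`, plus `1` for the factor `exp Y`.
  refine le_trans (Real.exp_le_exp.2 ?_)
    (exp_neg_le_of_le hc (by positivity) (hB.trans main) hb)
  have : Real.log (R * h) * ((R + 1) / h) ≤ 2 * Y := by
    have : (R + 1) / h ≤ 2 * (R / h) := by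
      rw [← mul_div_assoc]; gcongr; linarith
    have := mul_le_mul_of_nonneg_left this (zero_le_one.trans hlog)
    linarith
  linarith

/-- With `β = -log R / log h` one has `R^{1/β} = 1/h`, so the bound written with `β` is the bound
with `(R/h) log(Rh)`. The condition `h R^{1/3} > 1` becomes `β > 3` on taking logarithms. -/
lemma exists_exponent {h R : ℝ} (hh : 0 < h) (hh1 : h < 1) (hR : 1 < R)
    (hhR : 1 < h * R ^ (1 / 3 : ℝ)) :
    ∃ β : ℝ, 3 < β ∧ R = h ^ (-β) ∧ R ^ (1 + 1 / β) = R / h ∧ R ^ (1 - 1 / β) = R * h := by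
  have hR0 : 0 < R := by linarith
  have hl : Real.log h < 0 := Real.log_neg hh hh1
  have hlR : 0 < Real.log R := Real.log_pos hR
  have hlt : 0 < Real.log h + 1 / 3 * Real.log R := by
    have := Real.log_pos hhR
    rwa [Real.log_mul hh.ne' (Real.rpow_pos_of_pos hR0 _).ne', Real.log_rpow hR0] at this
  have hinv : R ^ (1 / (-(Real.log R / Real.log h))) = h⁻¹ := by
    rw [Real.rpow_def_of_pos hR0, ← Real.exp_log (inv_pos.2 hh), Real.log_inv]
    congr 1
    field_simp
  refine ⟨-(Real.log R / Real.log h), ?_, ?_, ?_, ?_⟩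
  · rw [← div_neg, lt_div_iff₀ (by linarith)]
    linarith
  · rw [neg_neg, Real.rpow_def_of_pos hh, mul_div_cancel₀ _ hl.ne, Real.exp_log hR0]
  · rw [Real.rpow_add hR0, Real.rpow_one, hinv, div_eq_mul_inv]
  · rw [Real.rpow_sub hR0, Real.rpow_one, hinv, div_inv_eq_mul]

lemma le_ballMass {h r : ℝ} (hh : 0 < h) (u : (Fin d → ℤ) → ℝ) {j : Fin d → ℤ}
    (hj : absPt h j < r) : h ^ d * |u j| ^ 2 ≤ ballMass h r u := by
  have : Finite {j : Fin d → ℤ // absPt h j < r} := (finite_absPt_lt hh r).to_subtype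
  refine mul_le_mul_of_nonneg_left ?_ (by positivity)
  exact (Summable.of_finite (f := fun j : {j : Fin d → ℤ // absPt h j < r} => |u j| ^ 2)).le_tsum
    ⟨j, hj⟩ fun _ _ => by positivity

end LowerBounds

end LatticeSchrodinger


/-! ### Assembly of the two regimes -/

theorem theorem1p6 (d : ℕ) (hd : 1 ≤ d) :
    -- case `h R^{1/3} ≤ 1`: `C = C(d, ‖V‖_∞)`, `R₀ = R₀(d, ‖V‖_∞, c)`
    (∀ M : ℝ, ∃ C : ℝ, 0 < C ∧ ∀ c : ℝ, 0 < c → ∃ R₀ : ℝ, 0 < R₀ ∧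
      ∀ h R : ℝ, 0 < h → R₀ ≤ R → h * R ^ (1 / 3 : ℝ) ≤ 1 →
      ∀ V u : (Fin d → ℤ) → ℝ, (∀ j, |V j| ≤ M) → LatticeSchrodinger.IsSolution h V u →
        c ≤ LatticeSchrodinger.ballMass h (R - 1) u →
        Real.exp (-C * R ^ (4 / 3 : ℝ)) ≤ LatticeSchrodinger.annulusMass h R u) ∧
    -- case `h R^{1/3} > 1`: `C = C(d)`
    (∃ C : ℝ, 0 < C ∧
      -- `R₀ = R₀(d, ‖V‖_∞, c)`, uniformly in `h`
      (∀ M c : ℝ, 0 < c → ∃ R₀ : ℝ, 0 < R₀ ∧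
        ∀ h R : ℝ, 0 < h → R₀ ≤ R → 1 < h * R ^ (1 / 3 : ℝ) →
        ∀ V u : (Fin d → ℤ) → ℝ, (∀ j, |V j| ≤ M) → LatticeSchrodinger.IsSolution h V u →
          c ≤ LatticeSchrodinger.ballMass h (R - 1) u →
          (h < 1 → ∃ β : ℝ, 3 < β ∧ R = h ^ (-β) ∧
            Real.exp (-C * R ^ (1 + 1 / β) * Real.log (R ^ (1 - 1 / β))) ≤
              LatticeSchrodinger.annulusMass h R u) ∧
          (h < 3 / 2 →
            Real.exp (-C * (R / h) * Real.log (R * h)) ≤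
              LatticeSchrodinger.annulusMass h R u)) ∧
      -- one nontrivial solution on one fixed lattice, `R` large
      (∀ h : ℝ, 0 < h → h < 3 / 2 →
        ∀ V u : (Fin d → ℤ) → ℝ, (∃ M : ℝ, ∀ j, |V j| ≤ M) →
          LatticeSchrodinger.IsSolution h V u → u ≠ 0 →
          ∃ R₀ : ℝ, 0 < R₀ ∧ ∀ R : ℝ, R₀ ≤ R →
            Real.exp (-C * (R / h) * Real.log (R * h)) ≤
              LatticeSchrodinger.annulusMass h R u)) := by
  let i : Fin d := ⟨0, hd⟩
  have coarse : ∀ M c : ℝ, 0 < c → ∃ R₀ : ℝ, 0 < R₀ ∧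
      ∀ h R : ℝ, 0 < h → h < 3 / 2 → R₀ ≤ R → 1 < h * R ^ (1 / 3 : ℝ) →
      ∀ V u : (Fin d → ℤ) → ℝ, (∀ j, |V j| ≤ M) → LatticeSchrodinger.IsSolution h V u →
        c ≤ LatticeSchrodinger.ballMass h (R - 1) u →
        1 < R ∧ Real.exp (-21 * (R / h) * Real.log (R * h)) ≤
          LatticeSchrodinger.annulusMass h R u := by
    intro M c hc
    have hp : (0 : ℝ) ≤ (3 + 18 * (d : ℝ) ^ 2 / c) ^ 3 := by positivity
    have hM := sq_nonneg M
    refine ⟨(3 + 18 * (d : ℝ) ^ 2 / c) ^ 3 + 24 * (M ^ 2 + 1), by positivity,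
      fun h R hh hh' hR hhR V u hV hu hB => ⟨by linarith, ?_⟩⟩
    exact LatticeSchrodinger.annulusMass_lower_bound_coarse i M hc hh hh' hR hhR hV hu.2 hB
  refine ⟨fun M => ⟨41 * (M ^ 2 + 1), by positivity, fun c hc =>
    ⟨1000 + |86700 * (d : ℝ) * (19 * d + 2 * M)| / c, by positivity,
      fun h R hh hR hhR V u hV hu hB =>
        LatticeSchrodinger.annulusMass_lower_bound_fine i M hc hh hR hhR hV hu.2 hB⟩⟩,
    21, by norm_num, fun M c hc => ?_, fun h hh hh' V u hV hu hne => ?_⟩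
  · obtain ⟨R₀, hR₀, H⟩ := coarse M c hc
    refine ⟨R₀, hR₀, fun h R hh hR hhR V u hV hu hB => ⟨fun h1 => ?_, fun h2 =>
      (H h R hh h2 hR hhR V u hV hu hB).2⟩⟩
    obtain ⟨hR1, hA⟩ := H h R hh (by linarith) hR hhR V u hV hu hB
    obtain ⟨β, hβ, hRβ, e1, e2⟩ := LatticeSchrodinger.exists_exponent hh h1 hR1 hhR
    exact ⟨β, hβ, hRβ, by rwa [e1, e2]⟩
  · obtain ⟨M, hM⟩ := hV
    obtain ⟨j, hj⟩ := Function.ne_iff.1 hne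
    have hj' : 0 < |u j| := abs_pos.2 hj
    -- A single nonzero value of `u` supplies the lower bound `c` once the ball contains its site.
    obtain ⟨R₀, hR₀, H⟩ := coarse M (h ^ d * |u j| ^ 2) (by positivity)
    have ha := LatticeSchrodinger.absPt_nonneg h j
    have hi : 0 < (h⁻¹) ^ 3 := by positivity
    -- The middle summand puts site `j` in the ball of radius `R - 1`; the last ensures `R > h⁻³`,
    -- that is `h R^{1/3} > 1`.
    refine ⟨R₀ + (LatticeSchrodinger.absPt h j + 2) + (h⁻¹) ^ 3, by positivity, fun R hR => ?_⟩
    refine (H h R hh hh' (by linarith) ?_ V u hM hu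
      (LatticeSchrodinger.le_ballMass hh u (by linarith))).2
    have : h⁻¹ < R ^ (1 / 3 : ℝ) := by
      calc h⁻¹ = ((h⁻¹) ^ 3) ^ (1 / 3 : ℝ) := by
            rw [← Real.rpow_natCast, ← Real.rpow_mul (by positivity)]; norm_num
        _ < R ^ (1 / 3 : ℝ) := Real.rpow_lt_rpow hi.le (by linarith) (by norm_num)
    calc 1 = h * h⁻¹ := (mul_inv_cancel₀ hh.ne').symm
      _ < _ := by gcongr
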